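/- Let $U\subseteq\mathbb R^2$ be open, let $\eta=(\eta^{ij})$ be a constant symmetric nondegenerate real $2\times 2$ matrix, let $g^{ij},\Gamma^{ij}_k,f^i$ ($i,j,k\in\{1,2\}$) be smooth functions on $U$ with $\det(g^{ij})\neq 0$ everywhere, and consider, on smooth fields $u=(u^1,u^2)(x)$ with values in compact subsets of $U$, the operators $$A^{ij}=\eta^{ij}\partial_x,\qquad B_0^{ij}=g^{ij}(u)\partial_x+\Gamma^{ij}_k(u)u^k_x,\qquad B^{ij}=B_0^{ij}+f^i(u)\,\partial_x^{-1}f^j(u),$$ where $\partial_x^{-1}h(x)=\tfrac12\big(\int_{-\infty}^x h\,dy-\int_x^{\infty}h\,dy\big)$. An operator $P$ is called Hamiltonian if $\{F,G\}_P=\int\frac{\delta F}{\delta u^i}P^{ij}\frac{\delta G}{\delta u^j}\,dx$ is skew-symmetric and satisfies the Jacobi identity on functionals of $u$ with smooth, compactly supported variational derivatives. Two Hamiltonian operators $P,Q$ are compatible (form a bi-Hamiltonian pair) if $P+\lambda Q$ is Hamiltonian for every $\lambda\in\mathbb R$. A vector field $f=f^i\partial_{u^i}$ is an infinitesimal isometry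 of a contravariant metric if the Lie derivative of the metric along $f$ vanishes. Then $A$ and $B$ form a bi-Hamiltonian pair if and only if 1. $A$ is compatible with $B_0$ (in particular $B_0$ is Hamiltonian), and 2. $f$ is an infinitesimal isometry of both $\eta^{ij}$ and $g^{ij}$. Moreover, if condition 2 holds, then $f$ is an infinitesimal isometry of $g^{ij}+\lambda\eta^{ij}$ for every $\lambda\in\mathbb R$. -/

import Mathlib

open scoped ContDiff Topology

noncomputable section

/-- A smooth finite-dimensional family `w p` (`p ∈ Ω`, `Ω` open in `ℝᵏ`) of fields
`x ↦ w p x ∈ U ⊆ ℝⁿ`: jointly smooth in `(p, x)`, and locally in `p` all values stay in one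
compact subset of `U`. -/
def IsSmoothFamily {n : ℕ} (U : Set (Fin n → ℝ)) {k : ℕ} (Ω : Set (Fin k → ℝ))
    (w : (Fin k → ℝ) → ℝ → Fin n → ℝ) : Prop :=
  IsOpen Ω ∧
  ContDiffOn ℝ ∞ (fun q : (Fin k → ℝ) × ℝ => w q.1 q.2) (Ω ×ˢ Set.univ) ∧
  ∀ p ∈ Ω, ∃ K : Set (Fin n → ℝ), IsCompact K ∧ K ⊆ U ∧ ∀ᶠ p' in 𝓝 p, ∀ x, w p' x ∈ K

/-- A single field: a smooth map `ℝ → U` with values in a compact subset of `U`. -/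
def IsFieldIn {n : ℕ} (U : Set (Fin n → ℝ)) (u : ℝ → Fin n → ℝ) : Prop :=
  ContDiff ℝ ∞ u ∧ ∃ K : Set (Fin n → ℝ), IsCompact K ∧ K ⊆ U ∧ ∀ x, u x ∈ K

/-- `dF` is the variational derivative `δF/δu` of the functional `F`: along every smooth family
of fields, `dF` is jointly smooth and (locally uniformly) compactly supported in `x`, and the
first variation of `F` is `∫ ∑ⱼ (δF/δuʲ) δuʲ dx`. Every local functional
`∫ h(x, u, uₓ, …) dx` with a smooth density of compact support in `x` has one,
namely its Euler-Lagrange expression. -/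
def IsVariationalDerivative {n : ℕ} (U : Set (Fin n → ℝ)) (F : (ℝ → Fin n → ℝ) → ℝ)
    (dF : (ℝ → Fin n → ℝ) → ℝ → Fin n → ℝ) : Prop :=
  ∀ (k : ℕ) (Ω : Set (Fin k → ℝ)) (w : (Fin k → ℝ) → ℝ → Fin n → ℝ),
    IsSmoothFamily U Ω w →
      ContDiffOn ℝ ∞ (fun q : (Fin k → ℝ) × ℝ => dF (w q.1) q.2) (Ω ×ˢ Set.univ) ∧
      (∀ p ∈ Ω, ∃ R : ℝ, ∀ᶠ p' in 𝓝 p, ∀ x : ℝ, R < |x| → dF (w p') x = 0) ∧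
      (∀ p ∈ Ω, ∀ e : Fin k → ℝ,
        HasDerivAt (fun s : ℝ => F (w (p + s • e)))
          (∫ x : ℝ, ∑ j, dF (w p) x j * deriv (fun s : ℝ => w (p + s • e) x j) 0) 0)

/-- A (possibly nonlocal) operator: to a field `u` and a covector `ψ = ψ(x)` it assigns the
vector `(P ψ)ⁱ(x) = Pⁱʲ ψⱼ (x)`. Sums and real multiples are taken pointwise. -/
abbrev FieldOperator (n : ℕ) : Type :=
  (ℝ → Fin n → ℝ) → (ℝ → Fin n → ℝ) → ℝ → Fin n → ℝ

/-- The skew-adjoint inverse of `d/dx`, with kernel `½ sgn(x - y)`, on integrable functions. -/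
def dxInv (h : ℝ → ℝ) (x : ℝ) : ℝ :=
  (1 / 2) * ((∫ y in Set.Iic x, h y) - ∫ y in Set.Ioi x, h y)

/-- The local first-order homogeneous operator `gⁱʲ(u) ∂ₓ + Γⁱʲₖ(u) uᵏₓ`. -/
def hydroOperator {n : ℕ} (g : (Fin n → ℝ) → Matrix (Fin n) (Fin n) ℝ)
    (Γ : (Fin n → ℝ) → Fin n → Fin n → Fin n → ℝ) : FieldOperator n :=
  fun u ψ x i =>
    ∑ j, (g (u x) i j * deriv (fun y => ψ y j) x
      + ∑ k, Γ (u x) i j k * deriv (fun y => u y k) x * ψ x j)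

/-- The nonlocal operator `fⁱ(u) ∂ₓ⁻¹ fʲ(u)`. -/
def tailOperator {n : ℕ} (f : (Fin n → ℝ) → Fin n → ℝ) : FieldOperator n :=
  fun u ψ x i => f (u x) i * dxInv (fun y => ∑ j, f (u y) j * ψ y j) x

/-- `{F, G}_P [u] = ∫ (δF/δuⁱ) Pⁱʲ (δG/δuʲ) dx`, in terms of the variational derivatives
`dF`, `dG` of `F`, `G`. -/
def poissonBracket {n : ℕ} (P : FieldOperator n) (dF dG : (ℝ → Fin n → ℝ) → ℝ → Fin n → ℝ)
    (u : ℝ → Fin n → ℝ) : ℝ :=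
  ∫ x : ℝ, ∑ i, dF u x i * P u (dG u) x i

/-- `P` is a Hamiltonian operator on fields with values in `U`: `{·,·}_P` is a Poisson bracket
on the functionals having a variational derivative, i.e. it is skew-symmetric and satisfies
`{{F,G},H} + {{G,H},F} + {{H,F},G} = 0`. Here `{K,H}`, for `K` a bracket, is the derivative of
`K` along the Hamiltonian vector field `P (δH/δu)`; that this derivative exists is required. -/
def IsHamiltonian {n : ℕ} (U : Set (Fin n → ℝ)) (P : FieldOperator n) : Prop :=
  (∀ (F G : (ℝ → Fin n → ℝ) → ℝ) (dF dG : (ℝ → Fin n → ℝ) → ℝ → Fin n → ℝ),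
    IsVariationalDerivative U F dF → IsVariationalDerivative U G dG →
    ∀ u, IsFieldIn U u → poissonBracket P dF dG u = -poissonBracket P dG dF u) ∧
  (∀ (F G H : (ℝ → Fin n → ℝ) → ℝ) (dF dG dH : (ℝ → Fin n → ℝ) → ℝ → Fin n → ℝ),
    IsVariationalDerivative U F dF → IsVariationalDerivative U G dG →
    IsVariationalDerivative U H dH →
    ∀ u, IsFieldIn U u → ∃ a b c : ℝ,
      HasDerivAt (fun s : ℝ => poissonBracket P dF dG (u + s • P u (dH u))) a 0 ∧
      HasDerivAt (fun s : ℝ => poissonBracket P dG dH (u + s • P u (dF u))) b 0 ∧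
      HasDerivAt (fun s : ℝ => poissonBracket P dH dF (u + s • P u (dG u))) c 0 ∧
      a + b + c = 0)

/-- Two Hamiltonian operators `P`, `Q` are compatible (form a bi-Hamiltonian pair) if
`P + c Q` is Hamiltonian for every real `c`. -/
def IsBiHamiltonianPair {n : ℕ} (U : Set (Fin n → ℝ)) (P Q : FieldOperator n) : Prop :=
  IsHamiltonian U P ∧ IsHamiltonian U Q ∧ ∀ c : ℝ, IsHamiltonian U (P + c • Q)

/-- Partial derivative `∂h/∂uᵏ`. -/
def partialDeriv {n : ℕ} (h : (Fin n → ℝ) → ℝ) (k : Fin n) (u : Fin n → ℝ) : ℝ :=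
  fderiv ℝ h u (Pi.single k 1)

/-- `f` is an infinitesimal isometry of the contravariant metric `gⁱʲ` on `U`: the Lie
derivative `fᵏ ∂ₖ gⁱʲ - gᵏʲ ∂ₖ fⁱ - gⁱᵏ ∂ₖ fʲ` vanishes. -/
def IsInfinitesimalIsometry {n : ℕ} (U : Set (Fin n → ℝ))
    (g : (Fin n → ℝ) → Matrix (Fin n) (Fin n) ℝ) (f : (Fin n → ℝ) → Fin n → ℝ) : Prop :=
  ∀ u ∈ U, ∀ i j, ∑ k, (f u k * partialDeriv (fun v => g v i j) k u
    - g u k j * partialDeriv (fun v => f v i) k u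
    - g u i k * partialDeriv (fun v => f v j) k u) = 0

end

/-!
A Hamiltonian operator need only be tested on covectors not depending on the field: in the Jacobi
identity for general functionals the derivatives of the variational derivatives cancel, because
second variations are symmetric. For `B₀ + ε f ∂ₓ⁻¹ f` with `B₀ = g ∂ₓ + Γ uₓ` skew-symmetric, the
Jacobi sum on test covectors has no term in `ε²`. Modulo total derivatives, its part linear in `ε`
pairs the potential `∂ₓ⁻¹(f · χ)` with the Lie derivative of `B₀` along `f`, plus a local term that
is alternating in the three covectors once `f` is an isometry, and hence vanishes in the plane.

If `f` is an isometry of a nondegenerate `g`, it preserves the Levi-Civita symbol too, so the Lie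
derivative of `B₀` vanishes and the Hamiltonian property does not depend on `ε`. Conversely, at a
constant field, test functions with separated supports see only the nonlocal part of the sum, which
is the Lie derivative of the metric. Applied to `B` and to `A + B`, this shows that `f` is an
isometry of both metrics.
-/

open MeasureTheory Set Filter Function

section ParametricIntegrals

variable {E F Z : Type*} [NormedAddCommGroup E] [NormedSpace ℝ E]
  [NormedAddCommGroup F] [NormedSpace ℝ F] [NormedAddCommGroup Z] [NormedSpace ℝ Z]

theorem fderiv_fderiv_apply_comm {f : E → F} {x : E} (hf : ContDiffAt ℝ 2 f x) (v w : E) :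
    fderiv ℝ (fun y => fderiv ℝ f y v) x w = fderiv ℝ (fun y => fderiv ℝ f y w) x v := by
  have hdiff : DifferentiableAt ℝ (fderiv ℝ f) x :=
    (hf.fderiv_right (m := 1) le_rfl).differentiableAt one_ne_zero
  have hsymm : IsSymmSndFDerivAt ℝ f x := hf.isSymmSndFDerivAt (by simp)
  simp only [fderiv_clm_apply hdiff (differentiableAt_const _), fderiv_fun_const, Pi.zero_apply,
    ContinuousLinearMap.comp_zero, zero_add, ContinuousLinearMap.flip_apply]
  exact hsymm w v

theorem hasDerivAt_left_of_hasFDerivAt {w : ℝ → ℝ → F} {w' : ℝ × ℝ →L[ℝ] F} {t x : ℝ}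
    (hw : HasFDerivAt (uncurry w) w' (t, x)) : HasDerivAt (w · x) (w' (1, 0)) t := by
  simpa [comp_def] using (hw.comp t (hasFDerivAt_prodMk_left t x)).hasDerivAt

theorem hasDerivAt_right_of_hasFDerivAt {w : ℝ → ℝ → F} {w' : ℝ × ℝ →L[ℝ] F} {t x : ℝ}
    (hw : HasFDerivAt (uncurry w) w' (t, x)) : HasDerivAt (w t) (w' (0, 1)) x := by
  simpa [comp_def] using (hw.comp x (hasFDerivAt_prodMk_right t x)).hasDerivAt

theorem deriv_swap_of_hasDerivAt_partial {Φ A B : ℝ → ℝ → F} {Ω : Set (ℝ × ℝ)} (hΩ : IsOpen Ω)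
    (hΦA : ∀ q ∈ Ω, HasDerivAt (Φ · q.2) (A q.1 q.2) q.1)
    (hΦB : ∀ q ∈ Ω, HasDerivAt (Φ q.1 ·) (B q.1 q.2) q.2)
    (hA : DifferentiableOn ℝ (uncurry A) Ω) (hB : DifferentiableOn ℝ (uncurry B) Ω)
    {s t : ℝ} (hst : (s, t) ∈ Ω) : deriv (A s ·) t = deriv (B · t) s := by
  let D (q : ℝ × ℝ) : ℝ × ℝ →L[ℝ] F :=
    (ContinuousLinearMap.fst ℝ ℝ ℝ).smulRight (A q.1 q.2) +
      (ContinuousLinearMap.snd ℝ ℝ ℝ).smulRight (B q.1 q.2)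
  have hD : ∀ q ∈ Ω, HasFDerivAt (uncurry Φ) (D q) q := fun q hq => by
    refine (hasStrictFDerivAt_uncurry_coprod (u := q) (f := Φ)
      (f₁ := fun s t => .toSpanSingleton ℝ (A s t)) (f₂ := fun s t => .toSpanSingleton ℝ (B s t))
      ?_ ?_ ?_ ?_).hasFDerivAt.congr_fderiv (by ext <;> simp [D, HasUncurry.uncurry])
    · exact (hΩ.eventually_mem hq).mono fun q hq => (hΦA q hq).hasFDerivAt
    · exact (hΩ.eventually_mem hq).mono fun q hq => (hΦB q hq).hasFDerivAt
    · exact (ContinuousLinearMap.toSpanSingletonCLE (𝕜 := ℝ)).continuous.continuousAt.comp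
        (hA.continuousOn.continuousAt (hΩ.mem_nhds hq))
    · exact (ContinuousLinearMap.toSpanSingletonCLE (𝕜 := ℝ)).continuous.continuousAt.comp
        (hB.continuousOn.continuousAt (hΩ.mem_nhds hq))
  have hA' := (hA.hasFDerivAt (hΩ.mem_nhds hst))
  have hB' := (hB.hasFDerivAt (hΩ.mem_nhds hst))
  have hD' := ((ContinuousLinearMap.smulRightL ℝ (ℝ × ℝ) F (.fst ℝ ℝ ℝ)).hasFDerivAt.comp _ hA').add
    ((ContinuousLinearMap.smulRightL ℝ (ℝ × ℝ) F (.snd ℝ ℝ ℝ)).hasFDerivAt.comp _ hB')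
  have hsymm := second_derivative_symmetric_of_eventually (𝕜 := ℝ) (f' := D)
    ((hΩ.eventually_mem hst).mono hD) hD' (0, 1) (1, 0)
  rw [(hasDerivAt_right_of_hasFDerivAt hA').deriv, (hasDerivAt_left_of_hasFDerivAt hB').deriv]
  simpa using hsymm

variable {h : E → Z → F} {Ω : Set E} {p : E} {z : Z}

theorem hasFDerivAt_left_of_contDiffOn (hΩ : IsOpen Ω)
    (hh : ContDiffOn ℝ 1 (uncurry h) (Ω ×ˢ univ)) (hp : p ∈ Ω) :
    HasFDerivAt (h · z) ((fderiv ℝ (uncurry h) (p, z)).comp (.inl ℝ E Z)) p :=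
  ((hh.differentiableOn one_ne_zero).hasFDerivAt
    ((hΩ.prod isOpen_univ).mem_nhds ⟨hp, mem_univ z⟩)).comp p (hasFDerivAt_prodMk_left p z)

theorem continuousOn_fderiv_left (hΩ : IsOpen Ω) (hh : ContDiffOn ℝ 1 (uncurry h) (Ω ×ˢ univ)) :
    ContinuousOn (fun q : E × Z => fderiv ℝ (h · q.2) q.1) (Ω ×ˢ univ) :=
  ((hh.continuousOn_fderiv_of_isOpen (hΩ.prod isOpen_univ) le_rfl).clm_comp
    continuousOn_const).congr fun _ hq => (hasFDerivAt_left_of_contDiffOn hΩ hh hq.1).fderiv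

theorem exists_eventually_norm_fderiv_left_le (hΩ : IsOpen Ω)
    (hh : ContDiffOn ℝ 1 (uncurry h) (Ω ×ˢ univ)) (hp : p ∈ Ω) {K : Set Z} (hK : IsCompact K)
    (hs : ∀ᶠ q in 𝓝 p, ∀ z ∉ K, h q z = 0) :
    ∃ M, ∀ᶠ q in 𝓝 p, ∀ z, ‖fderiv ℝ (h · z) q‖ ≤ K.indicator (fun _ => M) z := by
  have hcont := continuousOn_fderiv_left hΩ hh
  obtain ⟨M, hM⟩ := hK.exists_bound_of_continuousOn
    (hcont.comp (f := fun z => (p, z)) (by fun_prop) fun z _ => ⟨hp, mem_univ z⟩)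
  have hinside : ∀ᶠ q in 𝓝 p, ∀ z ∈ K, ‖fderiv ℝ (h · z) q‖ < M + 1 :=
    hK.eventually_forall_of_forall_eventually fun z hz =>
      (hcont.continuousAt ((hΩ.prod isOpen_univ).mem_nhds ⟨hp, mem_univ z⟩)).norm.eventually_lt
        continuousAt_const ((hM z hz).trans_lt (lt_add_one M))
  refine ⟨M + 1, ?_⟩
  filter_upwards [hinside, hs.eventually_nhds] with q hq hq0 z
  by_cases hz : z ∈ K
  · simpa [hz] using (hq z hz).le
  · have : (h · z) =ᶠ[𝓝 q] fun _ => 0 := hq0.mono fun q' hq' => hq' z hz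
    simp [hz, this.fderiv_eq]

theorem hasFDerivAt_integral_smul_of_contDiffOn [MeasurableSpace Z] [BorelSpace Z]
    [SecondCountableTopology Z] {μ : Measure Z} [IsFiniteMeasureOnCompacts μ] {κ : Z → ℝ}
    (hκ : Measurable κ) {C : ℝ} (hC : ∀ z, |κ z| ≤ C) (hΩ : IsOpen Ω)
    (hh : ContDiffOn ℝ 1 (uncurry h) (Ω ×ˢ univ)) (hp : p ∈ Ω) {K : Set Z} (hK : IsCompact K)
    (hs : ∀ᶠ q in 𝓝 p, ∀ z ∉ K, h q z = 0) :
    Integrable (fun z => κ z • fderiv ℝ (h · z) p) μ ∧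
      HasFDerivAt (fun q => ∫ z, κ z • h q z ∂μ) (∫ z, κ z • fderiv ℝ (h · z) p ∂μ) p := by
  obtain ⟨M, hM⟩ := exists_eventually_norm_fderiv_left_le hΩ hh hp hK hs
  have hslice : ∀ q ∈ Ω, Continuous (h q) := fun q hq =>
    hh.continuousOn.comp_continuous (f := fun z => (q, z)) (by fun_prop) fun z => ⟨hq, mem_univ z⟩
  have hbound_integrable : Integrable (K.indicator fun _ => C * M) μ :=
    (integrable_indicator_iff hK.measurableSet).2 (integrableOn_const hK.measure_lt_top.ne)
  have hbound : ∀ q, (∀ z, ‖fderiv ℝ (h · z) q‖ ≤ K.indicator (fun _ => M) z) →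
      ∀ z, ‖κ z • fderiv ℝ (h · z) q‖ ≤ K.indicator (fun _ => C * M) z := fun q hq z => by
    rw [norm_smul, ← smul_eq_mul C, ← smul_eq_mul, indicator_const_smul_apply]
    exact mul_le_mul (hC z) (hq z) (norm_nonneg _) ((abs_nonneg _).trans (hC z))
  have hmeas : AEStronglyMeasurable (fun z => κ z • fderiv ℝ (h · z) p) μ :=
    hκ.aestronglyMeasurable.smul ((continuousOn_fderiv_left hΩ hh).comp_continuous
      (f := fun z => (p, z)) (by fun_prop) fun z => ⟨hp, mem_univ z⟩).aestronglyMeasurable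
  refine ⟨hbound_integrable.mono' hmeas (ae_of_all _ (hbound p hM.self_of_nhds)),
    hasFDerivAt_integral_of_dominated_of_fderiv_le (hM.and (hΩ.eventually_mem hp)) ?_ ?_ hmeas
      (ae_of_all _ fun z q hq => hbound q hq.1 z) hbound_integrable
      (ae_of_all _ fun z q hq =>
        (hasFDerivAt_left_of_contDiffOn hΩ hh hq.2).differentiableAt.hasFDerivAt.const_smul (κ z))⟩
  · filter_upwards [hΩ.mem_nhds hp] with q hq
    exact hκ.aestronglyMeasurable.smul (hslice q hq).aestronglyMeasurable
  · exact ((hslice p hp).integrable_of_hasCompactSupport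
      (.intro hK hs.self_of_nhds)).bdd_smul C hκ.aestronglyMeasurable (ae_of_all _ hC)

end ParametricIntegrals

section TestFunctions

variable {E : Type*} [NormedAddCommGroup E] [NormedSpace ℝ E]

/-- Test functions on the line: smooth compactly supported maps, with values in a normed space. -/
structure IsTest (a : ℝ → E) : Prop where
  contDiff : ContDiff ℝ ∞ a
  hasCompactSupport : HasCompactSupport a

namespace IsTest

variable {a b : ℝ → E}

theorem integrable (ha : IsTest a) : Integrable a :=
  ha.contDiff.continuous.integrable_of_hasCompactSupport ha.hasCompactSupport

theorem smul {c : ℝ → ℝ} (hc : ContDiff ℝ ∞ c) (ha : IsTest a) : IsTest fun x => c x • a x :=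
  ⟨hc.smul ha.contDiff, ha.hasCompactSupport.smul_left⟩

theorem mul_left {a c : ℝ → ℝ} (hc : ContDiff ℝ ∞ c) (ha : IsTest a) : IsTest fun x => c x * a x :=
  ha.smul hc

theorem mul_right {a c : ℝ → ℝ} (ha : IsTest a) (hc : ContDiff ℝ ∞ c) :
    IsTest fun x => a x * c x := by
  simpa only [mul_comm] using ha.mul_left hc

theorem add (ha : IsTest a) (hb : IsTest b) : IsTest fun x => a x + b x :=
  ⟨ha.contDiff.add hb.contDiff, ha.hasCompactSupport.add hb.hasCompactSupport⟩

theorem sub (ha : IsTest a) (hb : IsTest b) : IsTest fun x => a x - b x :=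
  ⟨ha.contDiff.sub hb.contDiff, ha.hasCompactSupport.sub hb.hasCompactSupport⟩

theorem sum {ι : Type*} {s : Finset ι} {a : ι → ℝ → E} (ha : ∀ i ∈ s, IsTest (a i)) :
    IsTest fun x => ∑ i ∈ s, a i x := by
  classical
  induction s using Finset.induction_on with
  | empty => simpa using ⟨contDiff_const, HasCompactSupport.zero⟩
  | insert i s hi ih =>
    simp only [Finset.sum_insert hi]
    exact (ha i (Finset.mem_insert_self i s)).add
      (ih fun j hj => ha j (Finset.mem_insert_of_mem hj))

theorem pi {ι : Type*} [Fintype ι] {a : ℝ → ι → ℝ} (ha : ∀ i, IsTest fun x => a x i) : IsTest a :=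
  ⟨contDiff_pi.2 fun i => (ha i).contDiff,
    .intro (isCompact_iUnion fun i => (ha i).hasCompactSupport) fun _ hx => funext fun i =>
      image_eq_zero_of_notMem_tsupport (f := fun x => a x i) fun hi => hx (mem_iUnion.2 ⟨i, hi⟩)⟩

theorem apply {ι : Type*} [Fintype ι] {a : ℝ → ι → ℝ} (ha : IsTest a) (i : ι) :
    IsTest fun x => a x i :=
  ⟨contDiff_pi.1 ha.contDiff i, ha.hasCompactSupport.comp_left (g := fun v : ι → ℝ => v i) rfl⟩

protected theorem deriv (ha : IsTest a) : IsTest (deriv a) :=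
  ⟨(contDiff_infty_iff_deriv.1 ha.contDiff).2, ha.hasCompactSupport.deriv⟩

theorem hasDerivAt (ha : IsTest a) (x : ℝ) : HasDerivAt a (deriv a x) x :=
  ((contDiff_infty_iff_deriv.1 ha.contDiff).1 x).hasDerivAt

theorem integral_deriv (ha : IsTest a) : ∫ x, deriv a x = 0 :=
  integral_eq_zero_of_hasDerivAt_of_integrable ha.hasDerivAt ha.deriv.integrable ha.integrable

end IsTest

end TestFunctions

section InverseDerivative

/-- The kernel of `dxInv`. -/
noncomputable def halfSign (z : ℝ × ℝ) : ℝ := (1 / 2) * Real.sign (z.1 - z.2)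

theorem measurable_halfSign : Measurable halfSign := by
  have : Measurable Real.sign :=
    Measurable.ite measurableSet_Iio measurable_const
      (Measurable.ite measurableSet_Ioi measurable_const measurable_const)
  exact (this.comp (measurable_fst.sub measurable_snd)).const_mul _

theorem abs_halfSign_le (z : ℝ × ℝ) : |halfSign z| ≤ 1 / 2 := by
  unfold halfSign
  rcases Real.sign_apply_eq (z.1 - z.2) with h | h | h <;> rw [h] <;> norm_num [abs_le]

theorem halfSign_swap (z : ℝ × ℝ) : halfSign z.swap = -halfSign z := by
  simp only [halfSign, Prod.fst_swap, Prod.snd_swap]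
  rw [← neg_sub z.1 z.2, Real.sign_neg, mul_neg]

variable {a b : ℝ → ℝ}

theorem setIntegral_Iic_add_Ioi (ha : Integrable a) (x : ℝ) :
    (∫ y in Iic x, a y) + ∫ y in Ioi x, a y = ∫ y, a y := by
  rw [← setIntegral_union (Iic_disjoint_Ioi le_rfl) measurableSet_Ioi ha.integrableOn
    ha.integrableOn, Iic_union_Ioi, setIntegral_univ]

theorem dxInv_eq_integral_halfSign (ha : Integrable a) (x : ℝ) :
    dxInv a x = ∫ y, halfSign (x, y) * a y := by
  have hint : Integrable fun y => halfSign (x, y) * a y :=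
    ha.bdd_mul (measurable_halfSign.comp measurable_prodMk_left).aestronglyMeasurable
      (ae_of_all _ fun y => abs_halfSign_le (x, y))
  have hleft : ∫ y in Iio x, halfSign (x, y) * a y = ∫ y in Iio x, (1 / 2) * a y :=
    setIntegral_congr_fun measurableSet_Iio fun y hy => by
      simp only [halfSign, Real.sign_of_pos (sub_pos.2 hy), mul_one]
  have hright : ∫ y in Ioi x, halfSign (x, y) * a y = ∫ y in Ioi x, (-(1 / 2)) * a y :=
    setIntegral_congr_fun measurableSet_Ioi fun y hy => by
      simp only [halfSign, Real.sign_of_neg (sub_neg.2 hy), mul_neg, mul_one]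
  rw [← setIntegral_Iic_add_Ioi hint x, integral_Iic_eq_integral_Iio, hleft, hright,
    integral_const_mul, integral_const_mul, dxInv, integral_Iic_eq_integral_Iio]
  ring

theorem integrable_halfSign_mul (ha : Integrable a) (hb : Integrable b) :
    Integrable fun z : ℝ × ℝ => halfSign z * (a z.1 * b z.2) :=
  (ha.mul_prod hb).bdd_mul measurable_halfSign.aestronglyMeasurable (ae_of_all _ abs_halfSign_le)

theorem integral_mul_dxInv (ha : Integrable a) (hb : Integrable b) :
    ∫ x, a x * dxInv b x = ∫ z : ℝ × ℝ, halfSign z * (a z.1 * b z.2) := by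
  rw [Measure.volume_eq_prod, integral_prod _ (integrable_halfSign_mul ha hb)]
  refine integral_congr_ae (ae_of_all _ fun x => ?_)
  simp only [dxInv_eq_integral_halfSign hb, ← integral_const_mul, mul_left_comm]

theorem integral_mul_dxInv_swap (ha : Integrable a) (hb : Integrable b) :
    ∫ x, a x * dxInv b x = -∫ x, b x * dxInv a x := by
  rw [integral_mul_dxInv ha hb, integral_mul_dxInv hb ha, Measure.volume_eq_prod,
    ← integral_prod_swap, ← integral_neg]
  simp only [halfSign_swap, Prod.fst_swap, Prod.snd_swap, mul_comm (a _), neg_mul]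

theorem dxInv_add (ha : Integrable a) (hb : Integrable b) (x : ℝ) :
    dxInv (fun y => a y + b y) x = dxInv a x + dxInv b x := by
  rw [dxInv, integral_add ha.integrableOn hb.integrableOn,
    integral_add ha.integrableOn hb.integrableOn, dxInv, dxInv]
  ring

theorem abs_dxInv_le (ha : Integrable a) (x : ℝ) : |dxInv a x| ≤ ∫ y, |a y| := by
  rw [dxInv_eq_integral_halfSign ha]
  refine (norm_integral_le_integral_norm _).trans (integral_mono_of_nonneg
    (ae_of_all _ fun y => norm_nonneg (halfSign (x, y) * a y)) ha.abs (ae_of_all _ fun y => ?_))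
  simp only [norm_mul, Real.norm_eq_abs]
  exact mul_le_of_le_one_left (abs_nonneg _) ((abs_halfSign_le _).trans (by norm_num))

theorem dxInv_eq_of_forall_le {x : ℝ} (hx : ∀ y ≤ x, a y = 0) :
    dxInv a x = -(1 / 2) * ∫ y, a y := by
  have hleft : ∫ y in Iic x, a y = 0 := setIntegral_eq_zero_of_forall_eq_zero hx
  have hright : ∫ y in Ioi x, a y = ∫ y, a y :=
    setIntegral_eq_integral_of_forall_compl_eq_zero fun y hy => hx y (not_lt.1 hy)
  rw [dxInv, hleft, hright]
  ring

theorem hasDerivAt_dxInv (ha : Integrable a) (hc : Continuous a) (x : ℝ) :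
    HasDerivAt (dxInv a) (a x) x := by
  have hprimitive : dxInv a = fun x => (∫ y in (0 : ℝ)..x, a y) +
      ((∫ y in Iic 0, a y) - (1 / 2) * ∫ y, a y) := funext fun x => by
    rw [dxInv, ← intervalIntegral.integral_Iic_sub_Iic ha.integrableOn ha.integrableOn,
      ← setIntegral_Iic_add_Ioi ha x]
    ring
  rw [hprimitive]
  exact (hc.integral_hasStrictDerivAt 0 x).hasDerivAt.add_const _

theorem IsTest.hasDerivAt_dxInv (ha : IsTest a) (x : ℝ) : HasDerivAt (dxInv a) (a x) x :=
  _root_.hasDerivAt_dxInv ha.integrable ha.contDiff.continuous x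

theorem IsTest.contDiff_dxInv (ha : IsTest a) : ContDiff ℝ ∞ (dxInv a) := by
  rw [contDiff_infty_iff_deriv, funext fun x => (ha.hasDerivAt_dxInv x).deriv]
  exact ⟨fun x => (ha.hasDerivAt_dxInv x).differentiableAt, ha.contDiff⟩

end InverseDerivative

section SmoothPaths

variable {E : Type*} [NormedAddCommGroup E] [NormedSpace ℝ E] {I : Set ℝ}

/-- The velocity at time `0` of a path `t ↦ w t` of functions on the line. -/
noncomputable def timeDeriv (w : ℝ → ℝ → E) (x : ℝ) : E := deriv (w · x) 0

/-- Jointly smooth paths `t ↦ w t` of functions on the line, for times in an open set `I ∋ 0`. -/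
structure IsSmoothPath (I : Set ℝ) (w : ℝ → ℝ → E) : Prop where
  isOpen : IsOpen I
  zero_mem : (0 : ℝ) ∈ I
  contDiffOn : ContDiffOn ℝ ∞ (uncurry w) (I ×ˢ univ)

namespace IsSmoothPath

variable {w : ℝ → ℝ → E} {a b : ℝ → ℝ → ℝ}

theorem hasFDerivAt (hw : IsSmoothPath I w) {t : ℝ} (ht : t ∈ I) (x : ℝ) :
    HasFDerivAt (uncurry w) (fderiv ℝ (uncurry w) (t, x)) (t, x) :=
  (hw.contDiffOn.differentiableOn (by simp)).hasFDerivAt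
    ((hw.isOpen.prod isOpen_univ).mem_nhds ⟨ht, mem_univ x⟩)

theorem contDiffOn_fderiv_apply (hw : IsSmoothPath I w) (e : ℝ × ℝ) :
    ContDiffOn ℝ ∞ (fun q => fderiv ℝ (uncurry w) q e) (I ×ˢ univ) :=
  (hw.contDiffOn.fderiv_of_isOpen (hw.isOpen.prod isOpen_univ) le_rfl).clm_apply contDiffOn_const

theorem timeDeriv_eq (hw : IsSmoothPath I w) (x : ℝ) :
    timeDeriv w x = fderiv ℝ (uncurry w) (0, x) (1, 0) :=
  (hasDerivAt_left_of_hasFDerivAt (hw.hasFDerivAt hw.zero_mem x)).deriv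

theorem hasDerivAt (hw : IsSmoothPath I w) (x : ℝ) : HasDerivAt (w · x) (timeDeriv w x) 0 := by
  rw [hw.timeDeriv_eq]
  exact hasDerivAt_left_of_hasFDerivAt (hw.hasFDerivAt hw.zero_mem x)

theorem contDiff_slice (hw : IsSmoothPath I w) {t : ℝ} (ht : t ∈ I) : ContDiff ℝ ∞ (w t) :=
  hw.contDiffOn.comp_contDiff (f := fun x => (t, x)) (by fun_prop) fun x => ⟨ht, mem_univ x⟩

theorem contDiff_timeDeriv (hw : IsSmoothPath I w) : ContDiff ℝ ∞ (timeDeriv w) := by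
  rw [funext hw.timeDeriv_eq]
  exact (hw.contDiffOn_fderiv_apply (1, 0)).comp_contDiff (f := fun x => ((0 : ℝ), x))
    (by fun_prop) fun x => ⟨hw.zero_mem, mem_univ x⟩

protected theorem deriv (hw : IsSmoothPath I w) : IsSmoothPath I fun t => deriv (w t) :=
  ⟨hw.isOpen, hw.zero_mem, (hw.contDiffOn_fderiv_apply (0, 1)).congr fun q hq =>
    (hasDerivAt_right_of_hasFDerivAt (hw.hasFDerivAt hq.1 q.2)).deriv⟩

theorem timeDeriv_deriv (hw : IsSmoothPath I w) (x : ℝ) :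
    timeDeriv (fun t => deriv (w t)) x = deriv (timeDeriv w) x := by
  have hmem : I ×ˢ (univ : Set ℝ) ∈ 𝓝 ((0 : ℝ), x) :=
    (hw.isOpen.prod isOpen_univ).mem_nhds ⟨hw.zero_mem, mem_univ x⟩
  have hdiff : ∀ e, HasFDerivAt (fun q => fderiv ℝ (uncurry w) q e)
      (fderiv ℝ (fun q => fderiv ℝ (uncurry w) q e) (0, x)) (0, x) := fun e =>
    ((hw.contDiffOn_fderiv_apply e).differentiableOn (by simp)).hasFDerivAt hmem
  have hspace : (fun t => deriv (w t) x) =ᶠ[𝓝 0] fun t => fderiv ℝ (uncurry w) (t, x) (0, 1) := by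
    filter_upwards [hw.isOpen.mem_nhds hw.zero_mem] with t ht
    exact (hasDerivAt_right_of_hasFDerivAt (hw.hasFDerivAt ht x)).deriv
  calc timeDeriv (fun t => deriv (w t)) x
      = fderiv ℝ (fun q => fderiv ℝ (uncurry w) q (0, 1)) (0, x) (1, 0) :=
        hspace.deriv_eq.trans (hasDerivAt_left_of_hasFDerivAt
          (w := fun t x => fderiv ℝ (uncurry w) (t, x) (0, 1)) (hdiff _)).deriv
    _ = fderiv ℝ (fun q => fderiv ℝ (uncurry w) q (1, 0)) (0, x) (0, 1) :=
        fderiv_fderiv_apply_comm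
          ((hw.contDiffOn.contDiffAt hmem).of_le (WithTop.coe_le_coe.2 le_top)) _ _
    _ = deriv (timeDeriv w) x := by
        rw [funext hw.timeDeriv_eq]
        exact (hasDerivAt_right_of_hasFDerivAt
          (w := fun t x => fderiv ℝ (uncurry w) (t, x) (1, 0)) (hdiff _)).deriv.symm

theorem hasDerivAt_deriv (hw : IsSmoothPath I w) (x : ℝ) :
    HasDerivAt (fun t => deriv (w t) x) (deriv (timeDeriv w) x) 0 :=
  hw.timeDeriv_deriv x ▸ hw.deriv.hasDerivAt x

theorem mul (ha : IsSmoothPath I a) (hb : IsSmoothPath I b) :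
    IsSmoothPath I fun t x => a t x * b t x :=
  ⟨ha.isOpen, ha.zero_mem, ha.contDiffOn.mul hb.contDiffOn⟩

theorem add (ha : IsSmoothPath I a) (hb : IsSmoothPath I b) :
    IsSmoothPath I fun t x => a t x + b t x :=
  ⟨ha.isOpen, ha.zero_mem, ha.contDiffOn.add hb.contDiffOn⟩

theorem comp {F : Type*} [NormedAddCommGroup F] [NormedSpace ℝ F] {U : Set E} {h : E → F}
    (hw : IsSmoothPath I w) (hh : ContDiffOn ℝ ∞ h U) (hwU : ∀ t ∈ I, ∀ x, w t x ∈ U) :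
    IsSmoothPath I fun t x => h (w t x) :=
  ⟨hw.isOpen, hw.zero_mem, hh.comp hw.contDiffOn fun q hq => hwU q.1 hq.1 q.2⟩

theorem hasDerivAt_comp {F : Type*} [NormedAddCommGroup F] [NormedSpace ℝ F] {U : Set E}
    {h : E → F} (hw : IsSmoothPath I w) (hU : IsOpen U) (hh : ContDiffOn ℝ ∞ h U)
    (hwU : ∀ t ∈ I, ∀ x, w t x ∈ U) (x : ℝ) :
    HasDerivAt (fun t => h (w t x)) (fderiv ℝ h (w 0 x) (timeDeriv w x)) 0 :=
  ((hh.differentiableOn (by simp)).hasFDerivAt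
    (hU.mem_nhds (hwU 0 hw.zero_mem x))).comp_hasDerivAt (0 : ℝ) (hw.hasDerivAt x)

variable {ι : Type*} [Fintype ι] {v : ℝ → ℝ → ι → ℝ}

theorem sum {a : ι → ℝ → ℝ → ℝ} (hI : IsOpen I) (h0 : 0 ∈ I) (ha : ∀ i, IsSmoothPath I (a i)) :
    IsSmoothPath I fun t x => ∑ i, a i t x :=
  ⟨hI, h0, ContDiffOn.sum fun i _ => (ha i).contDiffOn⟩

theorem apply (hv : IsSmoothPath I v) (i : ι) : IsSmoothPath I fun t x => v t x i :=
  ⟨hv.isOpen, hv.zero_mem, contDiffOn_pi.1 hv.contDiffOn i⟩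

theorem pi (hI : IsOpen I) (h0 : 0 ∈ I) (hv : ∀ i, IsSmoothPath I fun t x => v t x i) :
    IsSmoothPath I v :=
  ⟨hI, h0, contDiffOn_pi.2 fun i => (hv i).contDiffOn⟩

theorem hasDerivAt_apply (hv : IsSmoothPath I v) (i : ι) (x : ℝ) :
    HasDerivAt (fun t => v t x i) (timeDeriv v x i) 0 :=
  hasDerivAt_pi.1 (hv.hasDerivAt x) i

theorem hasDerivAt_deriv_apply (hv : IsSmoothPath I v) (i : ι) (x : ℝ) :
    HasDerivAt (fun t => deriv (fun y => v t y i) x) (deriv (fun y => timeDeriv v y i) x) 0 := by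
  rw [← funext fun y => ((hv.hasDerivAt_apply i y).deriv : timeDeriv (fun t x => v t x i) y = _)]
  exact (hv.apply i).hasDerivAt_deriv x

end IsSmoothPath

/-- Smooth paths of test functions supported in a common compact set. -/
structure IsTestPath (I : Set ℝ) (w : ℝ → ℝ → E) : Prop extends IsSmoothPath I w where
  exists_isCompact : ∃ K, IsCompact K ∧ ∀ t ∈ I, ∀ x ∉ K, w t x = 0

namespace IsTestPath

variable {w : ℝ → ℝ → E} {a b : ℝ → ℝ → ℝ}

theorem isTest_slice (hw : IsTestPath I w) {t : ℝ} (ht : t ∈ I) : IsTest (w t) := by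
  obtain ⟨K, hK, hK0⟩ := hw.exists_isCompact
  exact ⟨hw.contDiff_slice ht, .intro hK (hK0 t ht)⟩

theorem isTest_timeDeriv (hw : IsTestPath I w) : IsTest (timeDeriv w) := by
  obtain ⟨K, hK, hK0⟩ := hw.exists_isCompact
  refine ⟨hw.contDiff_timeDeriv, .intro hK fun x hx => ?_⟩
  have hzero : (w · x) =ᶠ[𝓝 0] fun _ => 0 :=
    mem_of_superset (hw.isOpen.mem_nhds hw.zero_mem) fun t ht => hK0 t ht x hx
  rw [timeDeriv, hzero.deriv_eq, deriv_const]

theorem apply {ι : Type*} [Fintype ι] {v : ℝ → ℝ → ι → ℝ} (hv : IsTestPath I v) (i : ι) :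
    IsTestPath I fun t x => v t x i := by
  obtain ⟨K, hK, hK0⟩ := hv.exists_isCompact
  exact ⟨hv.toIsSmoothPath.apply i, K, hK, fun t ht x hx => congrFun (hK0 t ht x hx) i⟩

theorem dot {ι : Type*} [Fintype ι] {v w : ℝ → ℝ → ι → ℝ}
    (hv : IsTestPath I v) (hw : IsSmoothPath I w) :
    IsTestPath I fun t x => ∑ i, v t x i * w t x i := by
  obtain ⟨K, hK, hK0⟩ := hv.exists_isCompact
  exact ⟨.sum hw.isOpen hw.zero_mem fun i => (hv.apply i).mul (hw.apply i), K, hK,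
    fun t ht x hx => by simp [hK0 t ht x hx]⟩

theorem hasDerivAt_integral (ha : IsTestPath I a) :
    HasDerivAt (fun t => ∫ x, a t x) (∫ x, timeDeriv a x) 0 := by
  obtain ⟨K, hK, hK0⟩ := ha.exists_isCompact
  obtain ⟨hint, hderiv⟩ := hasFDerivAt_integral_smul_of_contDiffOn (μ := (volume : Measure ℝ))
    (κ := fun _ => 1) measurable_const (C := 1) (by simp) ha.isOpen
    (ha.contDiffOn.of_le (by exact_mod_cast le_top)) ha.zero_mem hK
    (mem_of_superset (ha.isOpen.mem_nhds ha.zero_mem) hK0)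
  simp only [one_smul] at hint hderiv
  simpa only [ContinuousLinearMap.integral_apply hint, fderiv_apply_one_eq_deriv, timeDeriv]
    using hderiv.hasDerivAt

/-- `∫ a ∂ₓ⁻¹ b` is an integral over the plane against the bounded kernel `halfSign`. -/
theorem hasDerivAt_integral_mul_dxInv (ha : IsTestPath I a) (hb : IsTestPath I b) :
    HasDerivAt (fun t => ∫ x, a t x * dxInv (b t) x)
      ((∫ x, timeDeriv a x * dxInv (b 0) x) + ∫ x, a 0 x * dxInv (timeDeriv b) x) 0 := by
  obtain ⟨K, hK, hK0⟩ := ha.exists_isCompact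
  obtain ⟨L, hL, hL0⟩ := hb.exists_isCompact
  have hI := ha.isOpen.mem_nhds ha.zero_mem
  have ha0 := (ha.isTest_slice ha.zero_mem).integrable
  have hb0 := (hb.isTest_slice hb.zero_mem).integrable
  have hsmooth : ContDiffOn ℝ ∞ (uncurry fun t (z : ℝ × ℝ) => a t z.1 * b t z.2) (I ×ˢ univ) :=
    (ha.contDiffOn.comp (f := fun q : ℝ × ℝ × ℝ => (q.1, q.2.1)) (by fun_prop)
      fun q hq => ⟨hq.1, mem_univ _⟩).mul
    (hb.contDiffOn.comp (f := fun q : ℝ × ℝ × ℝ => (q.1, q.2.2)) (by fun_prop)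
      fun q hq => ⟨hq.1, mem_univ _⟩)
  have hsupport : ∀ t ∈ I, ∀ z ∉ K ×ˢ L, a t z.1 * b t z.2 = 0 := fun t ht z hz => by
    rcases not_and_or.1 hz with h | h
    · rw [hK0 t ht _ h, zero_mul]
    · rw [hL0 t ht _ h, mul_zero]
  obtain ⟨hint, hderiv⟩ := hasFDerivAt_integral_smul_of_contDiffOn
    (μ := (volume : Measure (ℝ × ℝ))) measurable_halfSign abs_halfSign_le ha.isOpen
    (hsmooth.of_le (by exact_mod_cast le_top)) ha.zero_mem (hK.prod hL)
    (mem_of_superset hI hsupport)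
  rw [integral_mul_dxInv ha.isTest_timeDeriv.integrable hb0,
    integral_mul_dxInv ha0 hb.isTest_timeDeriv.integrable,
    ← integral_add (integrable_halfSign_mul ha.isTest_timeDeriv.integrable hb0)
      (integrable_halfSign_mul ha0 hb.isTest_timeDeriv.integrable)]
  refine (hderiv.hasDerivAt.congr_deriv ?_).congr_of_eventuallyEq ?_
  · rw [ContinuousLinearMap.integral_apply hint]
    refine integral_congr_ae (ae_of_all _ fun z => ?_)
    simp only [smul_apply, fderiv_apply_one_eq_deriv, smul_eq_mul,
      ((ha.hasDerivAt z.1).fun_mul (hb.hasDerivAt z.2)).deriv, mul_add]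
  · filter_upwards [hI] with t ht
    exact integral_mul_dxInv (ha.isTest_slice ht).integrable (hb.isTest_slice ht).integrable

end IsTestPath

end SmoothPaths

section Linearization

variable {n : ℕ}

/-- The operator `gⁱʲ ∂ₓ + Γⁱʲₖ uᵏₓ + ε fⁱ ∂ₓ⁻¹ fʲ`. -/
noncomputable def weaklyNonlocal (g : (Fin n → ℝ) → Matrix (Fin n) (Fin n) ℝ)
    (Γ : (Fin n → ℝ) → Fin n → Fin n → Fin n → ℝ) (f : (Fin n → ℝ) → Fin n → ℝ) (ε : ℝ) :
    FieldOperator n :=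
  hydroOperator g Γ + ε • tailOperator f

/-- The density `∑ⱼ fʲ(u) ψⱼ` on which the nonlocal tail of an operator acts. -/
noncomputable def contract (f : (Fin n → ℝ) → Fin n → ℝ) (u ψ : ℝ → Fin n → ℝ) (x : ℝ) : ℝ :=
  ∑ j, f (u x) j * ψ x j

/-- The bilinear form `∫ φᵢ Pⁱʲ ψⱼ dx` of an operator on test covectors. -/
noncomputable def pairing (P : FieldOperator n) (u φ ψ : ℝ → Fin n → ℝ) : ℝ :=
  ∫ x, ∑ i, φ x i * P u ψ x i

/-- The derivative of `hydroOperator g Γ u ψ` in the field `u`, in the direction `v`. -/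
noncomputable def hydroLinear (g : (Fin n → ℝ) → Matrix (Fin n) (Fin n) ℝ)
    (Γ : (Fin n → ℝ) → Fin n → Fin n → Fin n → ℝ) (u v ψ : ℝ → Fin n → ℝ) (x : ℝ) (i : Fin n) : ℝ :=
  ∑ j, (fderiv ℝ (fun w => g w i j) (u x) (v x) * deriv (fun y => ψ y j) x
    + ∑ k, (fderiv ℝ (fun w => Γ w i j k) (u x) (v x) * deriv (fun y => u y k) x
      + Γ (u x) i j k * deriv (fun y => v y k) x) * ψ x j)

/-- The derivative of `contract f u ψ` in the field `u`, in the direction `v`. -/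
noncomputable def contractLinear (f : (Fin n → ℝ) → Fin n → ℝ) (u v ψ : ℝ → Fin n → ℝ)
    (x : ℝ) : ℝ :=
  ∑ j, fderiv ℝ (fun w => f w j) (u x) (v x) * ψ x j

/-- The derivative of `pairing (weaklyNonlocal g Γ f ε) u φ ψ` in the field `u`, in the
direction `v`. -/
noncomputable def linearPairing (g : (Fin n → ℝ) → Matrix (Fin n) (Fin n) ℝ)
    (Γ : (Fin n → ℝ) → Fin n → Fin n → Fin n → ℝ) (f : (Fin n → ℝ) → Fin n → ℝ) (ε : ℝ)
    (u v φ ψ : ℝ → Fin n → ℝ) : ℝ :=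
  (∫ x, ∑ i, φ x i * hydroLinear g Γ u v ψ x i) +
    ε * ((∫ x, contractLinear f u v φ x * dxInv (contract f u ψ) x) +
      ∫ x, contract f u φ x * dxInv (contractLinear f u v ψ) x)

/-- Smoothness of the coefficients of `weaklyNonlocal` on an open set. -/
structure SmoothCoefficients (U : Set (Fin n → ℝ)) (g : (Fin n → ℝ) → Matrix (Fin n) (Fin n) ℝ)
    (Γ : (Fin n → ℝ) → Fin n → Fin n → Fin n → ℝ) (f : (Fin n → ℝ) → Fin n → ℝ) : Prop where
  isOpen : IsOpen U
  metric : ∀ i j, ContDiffOn ℝ ∞ (fun u => g u i j) U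
  symbol : ∀ i j k, ContDiffOn ℝ ∞ (fun u => Γ u i j k) U
  vector : ∀ i, ContDiffOn ℝ ∞ (fun u => f u i) U

/-- Smooth maps from the line to `U`: fields whose values need not stay in a compact subset. -/
structure IsSmoothIn (U : Set (Fin n → ℝ)) (u : ℝ → Fin n → ℝ) : Prop where
  contDiff : ContDiff ℝ ∞ u
  mem : ∀ x, u x ∈ U

theorem weaklyNonlocal_apply (g : (Fin n → ℝ) → Matrix (Fin n) (Fin n) ℝ)
    (Γ : (Fin n → ℝ) → Fin n → Fin n → Fin n → ℝ) (f : (Fin n → ℝ) → Fin n → ℝ) (ε : ℝ)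
    (u ψ : ℝ → Fin n → ℝ) (x : ℝ) (i : Fin n) :
    weaklyNonlocal g Γ f ε u ψ x i =
      hydroOperator g Γ u ψ x i + ε * (f (u x) i * dxInv (contract f u ψ) x) :=
  rfl

theorem contDiff_deriv_apply {v : ℝ → Fin n → ℝ} (hv : ContDiff ℝ ∞ v) (k : Fin n) :
    ContDiff ℝ ∞ (deriv fun x => v x k) :=
  (contDiff_infty_iff_deriv.1 (contDiff_pi.1 hv k)).2

variable {U : Set (Fin n → ℝ)} {g : (Fin n → ℝ) → Matrix (Fin n) (Fin n) ℝ}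
  {Γ : (Fin n → ℝ) → Fin n → Fin n → Fin n → ℝ} {f : (Fin n → ℝ) → Fin n → ℝ} {ε : ℝ}
  {u v φ ψ : ℝ → Fin n → ℝ}

theorem IsFieldIn.isSmoothIn (hu : IsFieldIn U u) : IsSmoothIn U u :=
  let ⟨hsmooth, _, _, hKU, hK⟩ := hu
  ⟨hsmooth, fun x => hKU (hK x)⟩

theorem IsSmoothIn.comp {h : (Fin n → ℝ) → ℝ} (hu : IsSmoothIn U u) (hh : ContDiffOn ℝ ∞ h U) :
    ContDiff ℝ ∞ fun x => h (u x) :=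
  hh.comp_contDiff hu.contDiff hu.mem

theorem IsSmoothIn.fderiv_apply (hu : IsSmoothIn U u) (hU : IsOpen U) {h : (Fin n → ℝ) → ℝ}
    (hh : ContDiffOn ℝ ∞ h U) (hv : ContDiff ℝ ∞ v) :
    ContDiff ℝ ∞ fun x => fderiv ℝ h (u x) (v x) :=
  ((hh.fderiv_of_isOpen hU le_rfl).comp_contDiff hu.contDiff hu.mem).clm_apply hv

theorem IsTest.dot (hφ : IsTest φ) (hψ : ContDiff ℝ ∞ ψ) : IsTest fun x => ∑ i, φ x i * ψ x i :=
  .sum fun i _ => (hφ.apply i).mul_right (contDiff_pi.1 hψ i)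

namespace SmoothCoefficients

theorem isTest_contract (hc : SmoothCoefficients U g Γ f) (hu : IsSmoothIn U u) (hψ : IsTest ψ) :
    IsTest (contract f u ψ) :=
  .sum fun j _ => (hψ.apply j).mul_left (hu.comp (hc.vector j))

theorem isTest_contractLinear (hc : SmoothCoefficients U g Γ f) (hu : IsSmoothIn U u)
    (hv : ContDiff ℝ ∞ v) (hψ : IsTest ψ) : IsTest (contractLinear f u v ψ) :=
  .sum fun j _ => (hψ.apply j).mul_left (hu.fderiv_apply hc.isOpen (hc.vector j) hv)

theorem isTest_hydroOperator (hc : SmoothCoefficients U g Γ f) (hu : IsSmoothIn U u)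
    (hψ : IsTest ψ) : IsTest (hydroOperator g Γ u ψ) :=
  .pi fun i => .sum fun j _ => ((hψ.apply j).deriv.mul_left (hu.comp (hc.metric i j))).add <|
    .sum fun k _ => (hψ.apply j).mul_left
      ((hu.comp (hc.symbol i j k)).mul (contDiff_deriv_apply hu.contDiff k))

theorem isTest_hydroLinear (hc : SmoothCoefficients U g Γ f) (hu : IsSmoothIn U u)
    (hv : ContDiff ℝ ∞ v) (hψ : IsTest ψ) : IsTest (hydroLinear g Γ u v ψ) :=
  .pi fun i => .sum fun j _ =>
    ((hψ.apply j).deriv.mul_left (hu.fderiv_apply hc.isOpen (hc.metric i j) hv)).add <|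
    .sum fun k _ => (hψ.apply j).mul_left <|
      ((hu.fderiv_apply hc.isOpen (hc.symbol i j k) hv).mul
        (contDiff_deriv_apply hu.contDiff k)).add
      ((hu.comp (hc.symbol i j k)).mul (contDiff_deriv_apply hv k))

theorem contDiff_tailOperator (hc : SmoothCoefficients U g Γ f) (hu : IsSmoothIn U u)
    (hψ : IsTest ψ) : ContDiff ℝ ∞ (tailOperator f u ψ) :=
  contDiff_pi.2 fun i => (hu.comp (hc.vector i)).mul (hc.isTest_contract hu hψ).contDiff_dxInv

theorem contDiff_weaklyNonlocal (hc : SmoothCoefficients U g Γ f) (hu : IsSmoothIn U u)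
    (hψ : IsTest ψ) : ContDiff ℝ ∞ (weaklyNonlocal g Γ f ε u ψ) :=
  (hc.isTest_hydroOperator hu hψ).contDiff.add ((hc.contDiff_tailOperator hu hψ).const_smul ε)

theorem pairing_weaklyNonlocal (hc : SmoothCoefficients U g Γ f) (hu : IsSmoothIn U u)
    (hφ : IsTest φ) (hψ : IsTest ψ) :
    pairing (weaklyNonlocal g Γ f ε) u φ ψ = (∫ x, ∑ i, φ x i * hydroOperator g Γ u ψ x i) +
      ε * ∫ x, contract f u φ x * dxInv (contract f u ψ) x := by
  rw [← integral_const_mul, ← integral_add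
    (hφ.dot (hc.isTest_hydroOperator hu hψ).contDiff).integrable
    (((hc.isTest_contract hu hφ).mul_right
      (hc.isTest_contract hu hψ).contDiff_dxInv).integrable.const_mul ε)]
  refine integral_congr_ae (ae_of_all _ fun x => ?_)
  simp only [weaklyNonlocal_apply, contract, mul_add, Finset.sum_add_distrib, Finset.sum_mul,
    Finset.mul_sum]
  congr! 2
  ring

variable {I : Set ℝ} {w Φ Ψ : ℝ → ℝ → Fin n → ℝ}

theorem isTestPath_contract (hc : SmoothCoefficients U g Γ f) (hw : IsSmoothPath I w)
    (hwU : ∀ t ∈ I, ∀ x, w t x ∈ U) (hΨ : IsTestPath I Ψ) :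
    IsTestPath I fun t x => contract f (w t) (Ψ t) x := by
  simpa only [contract, mul_comm] using
    hΨ.dot (.pi hw.isOpen hw.zero_mem fun i => hw.comp (hc.vector i) hwU)

theorem timeDeriv_contract (hc : SmoothCoefficients U g Γ f) (hw : IsSmoothPath I w)
    (hwU : ∀ t ∈ I, ∀ x, w t x ∈ U) (hΨ : IsTestPath I Ψ) (x : ℝ) :
    timeDeriv (fun t => contract f (w t) (Ψ t)) x =
      contract f (w 0) (timeDeriv Ψ) x + contractLinear f (w 0) (timeDeriv w) (Ψ 0) x := by
  refine (HasDerivAt.fun_sum fun j _ => (hw.hasDerivAt_comp hc.isOpen (hc.vector j) hwU x).fun_mul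
    (hΨ.hasDerivAt_apply j x)).deriv.trans ?_
  rw [Finset.sum_add_distrib, add_comm]
  rfl

theorem isSmoothPath_hydroOperator (hc : SmoothCoefficients U g Γ f) (hw : IsSmoothPath I w)
    (hwU : ∀ t ∈ I, ∀ x, w t x ∈ U) (hΨ : IsSmoothPath I Ψ) :
    IsSmoothPath I fun t => hydroOperator g Γ (w t) (Ψ t) :=
  .pi hw.isOpen hw.zero_mem fun i => .sum hw.isOpen hw.zero_mem fun j =>
    ((hw.comp (hc.metric i j) hwU).mul (hΨ.apply j).deriv).add <|
    .sum hw.isOpen hw.zero_mem fun k =>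
      ((hw.comp (hc.symbol i j k) hwU).mul (hw.apply k).deriv).mul (hΨ.apply j)

theorem hasDerivAt_hydroOperator (hc : SmoothCoefficients U g Γ f) (hw : IsSmoothPath I w)
    (hwU : ∀ t ∈ I, ∀ x, w t x ∈ U) (hΨ : IsSmoothPath I Ψ) (x : ℝ) (i : Fin n) :
    HasDerivAt (fun t => hydroOperator g Γ (w t) (Ψ t) x i)
      (hydroOperator g Γ (w 0) (timeDeriv Ψ) x i +
        hydroLinear g Γ (w 0) (timeDeriv w) (Ψ 0) x i) 0 := by
  refine (HasDerivAt.fun_sum fun j _ =>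
    ((hw.hasDerivAt_comp hc.isOpen (hc.metric i j) hwU x).fun_mul
      (hΨ.hasDerivAt_deriv_apply j x)).fun_add <| HasDerivAt.fun_sum fun k _ =>
    ((hw.hasDerivAt_comp hc.isOpen (hc.symbol i j k) hwU x).fun_mul
      (hw.hasDerivAt_deriv_apply k x)).fun_mul (hΨ.hasDerivAt_apply j x)).congr_deriv ?_
  simp only [hydroOperator, hydroLinear, add_mul, Finset.sum_add_distrib]
  ring

theorem hasDerivAt_integral_mul_hydroOperator (hc : SmoothCoefficients U g Γ f)
    (hw : IsSmoothPath I w) (hwU : ∀ t ∈ I, ∀ x, w t x ∈ U) (hΦ : IsTestPath I Φ)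
    (hΨ : IsTestPath I Ψ) :
    HasDerivAt (fun t => ∫ x, ∑ i, Φ t x i * hydroOperator g Γ (w t) (Ψ t) x i)
      ((∫ x, ∑ i, timeDeriv Φ x i * hydroOperator g Γ (w 0) (Ψ 0) x i) +
        (∫ x, ∑ i, Φ 0 x i * hydroOperator g Γ (w 0) (timeDeriv Ψ) x i) +
        ∫ x, ∑ i, Φ 0 x i * hydroLinear g Γ (w 0) (timeDeriv w) (Ψ 0) x i) 0 := by
  have hu : IsSmoothIn U (w 0) := ⟨hw.contDiff_slice hw.zero_mem, hwU 0 hw.zero_mem⟩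
  have hΦ0 := hΦ.isTest_slice hw.zero_mem
  have hΨ0 := hΨ.isTest_slice hw.zero_mem
  have hint₁ := hΦ.isTest_timeDeriv.dot (hc.isTest_hydroOperator hu hΨ0).contDiff
  have hint₂ := hΦ0.dot (hc.isTest_hydroOperator hu hΨ.isTest_timeDeriv).contDiff
  have hint₃ := hΦ0.dot (hc.isTest_hydroLinear hu hw.contDiff_timeDeriv hΨ0).contDiff
  have hpath := hc.isSmoothPath_hydroOperator hw hwU hΨ.toIsSmoothPath
  refine (hΦ.dot hpath).hasDerivAt_integral.congr_deriv ?_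
  rw [← integral_add hint₁.integrable hint₂.integrable,
    ← integral_add (hint₁.add hint₂).integrable hint₃.integrable]
  refine integral_congr_ae (ae_of_all _ fun x => (HasDerivAt.fun_sum fun i _ =>
    (hΦ.hasDerivAt_apply i x).fun_mul
      (hc.hasDerivAt_hydroOperator hw hwU hΨ.toIsSmoothPath x i)).deriv.trans ?_)
  simp only [mul_add, Finset.sum_add_distrib, add_assoc]

theorem hasDerivAt_integral_contract_mul_dxInv (hc : SmoothCoefficients U g Γ f)
    (hw : IsSmoothPath I w) (hwU : ∀ t ∈ I, ∀ x, w t x ∈ U) (hΦ : IsTestPath I Φ)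
    (hΨ : IsTestPath I Ψ) :
    HasDerivAt (fun t => ∫ x, contract f (w t) (Φ t) x * dxInv (contract f (w t) (Ψ t)) x)
      ((∫ x, contract f (w 0) (timeDeriv Φ) x * dxInv (contract f (w 0) (Ψ 0)) x) +
        (∫ x, contract f (w 0) (Φ 0) x * dxInv (contract f (w 0) (timeDeriv Ψ)) x) +
        ((∫ x, contractLinear f (w 0) (timeDeriv w) (Φ 0) x * dxInv (contract f (w 0) (Ψ 0)) x) +
        ∫ x, contract f (w 0) (Φ 0) x *
          dxInv (contractLinear f (w 0) (timeDeriv w) (Ψ 0)) x)) 0 := by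
  have hu : IsSmoothIn U (w 0) := ⟨hw.contDiff_slice hw.zero_mem, hwU 0 hw.zero_mem⟩
  have hv := hw.contDiff_timeDeriv
  have hΦ0 := hc.isTest_contract hu (hΦ.isTest_slice hw.zero_mem)
  have hΨ0 := hc.isTest_contract hu (hΨ.isTest_slice hw.zero_mem)
  have hΦ' := hc.isTest_contract hu hΦ.isTest_timeDeriv
  have hΨ' := hc.isTest_contract hu hΨ.isTest_timeDeriv
  have hΦv := hc.isTest_contractLinear hu hv (hΦ.isTest_slice hw.zero_mem)
  have hΨv := hc.isTest_contractLinear hu hv (hΨ.isTest_slice hw.zero_mem)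
  refine ((hc.isTestPath_contract hw hwU hΦ).hasDerivAt_integral_mul_dxInv
    (hc.isTestPath_contract hw hwU hΨ)).congr_deriv ?_
  simp only [funext (hc.timeDeriv_contract hw hwU hΦ), funext (hc.timeDeriv_contract hw hwU hΨ),
    dxInv_add hΨ'.integrable hΨv.integrable, add_mul, mul_add]
  rw [integral_add (hΦ'.mul_right hΨ0.contDiff_dxInv).integrable
      (hΦv.mul_right hΨ0.contDiff_dxInv).integrable,
    integral_add (hΦ0.mul_right hΨ'.contDiff_dxInv).integrable
      (hΦ0.mul_right hΨv.contDiff_dxInv).integrable]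
  ring

theorem hasDerivAt_pairing (hc : SmoothCoefficients U g Γ f) (hw : IsSmoothPath I w)
    (hwU : ∀ t ∈ I, ∀ x, w t x ∈ U) (hΦ : IsTestPath I Φ) (hΨ : IsTestPath I Ψ) :
    HasDerivAt (fun t => pairing (weaklyNonlocal g Γ f ε) (w t) (Φ t) (Ψ t))
      (pairing (weaklyNonlocal g Γ f ε) (w 0) (timeDeriv Φ) (Ψ 0) +
        pairing (weaklyNonlocal g Γ f ε) (w 0) (Φ 0) (timeDeriv Ψ) +
        linearPairing g Γ f ε (w 0) (timeDeriv w) (Φ 0) (Ψ 0)) 0 := by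
  have hsplit : ∀ t ∈ I, ∀ {φ ψ}, IsTest φ → IsTest ψ →
      pairing (weaklyNonlocal g Γ f ε) (w t) φ ψ = _ := fun t ht _ _ =>
    hc.pairing_weaklyNonlocal ⟨hw.contDiff_slice ht, hwU t ht⟩
  rw [hsplit 0 hw.zero_mem hΦ.isTest_timeDeriv (hΨ.isTest_slice hw.zero_mem),
    hsplit 0 hw.zero_mem (hΦ.isTest_slice hw.zero_mem) hΨ.isTest_timeDeriv, linearPairing]
  refine (((hc.hasDerivAt_integral_mul_hydroOperator hw hwU hΦ hΨ).add
    ((hc.hasDerivAt_integral_contract_mul_dxInv hw hwU hΦ hΨ).const_mul ε)).congr_deriv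
      (by ring)).congr_of_eventuallyEq ?_
  filter_upwards [hw.isOpen.mem_nhds hw.zero_mem] with t ht
  exact hsplit t ht (hΦ.isTest_slice ht) (hΨ.isTest_slice ht)

end SmoothCoefficients

end Linearization

section Variations

variable {n k : ℕ} {U : Set (Fin n → ℝ)} {Ω : Set (Fin k → ℝ)} {w : (Fin k → ℝ) → ℝ → Fin n → ℝ}
  {F : (ℝ → Fin n → ℝ) → ℝ} {dF : (ℝ → Fin n → ℝ) → ℝ → Fin n → ℝ} {p : Fin k → ℝ}

theorem eventually_forall_add_smul_of_eventually {E : Type*} [NormedAddCommGroup E]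
    [NormedSpace ℝ E] {P : E → Prop} {p : E} (hP : ∀ᶠ q in 𝓝 p, P q) (e : E) :
    ∀ᶠ r in 𝓝[>] (0 : ℝ), ∀ t ∈ Ioo (-r) r, P (p + t • e) := by
  have hline : Tendsto (fun t : ℝ => p + t • e) (𝓝 0) (𝓝 p) :=
    (by fun_prop : Continuous fun t : ℝ => p + t • e).tendsto' 0 p (by simp)
  obtain ⟨δ, hδ, hδP⟩ := Metric.eventually_nhds_iff.1 (hline.eventually hP)
  filter_upwards [Ioo_mem_nhdsGT hδ] with r hr t ht
  exact hδP (by simpa using (abs_lt.2 ht).trans hr.2)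

theorem IsSmoothFamily.eventually_isSmoothPath (hw : IsSmoothFamily U Ω w) (hp : p ∈ Ω)
    (e : Fin k → ℝ) : ∀ᶠ r in 𝓝[>] (0 : ℝ), IsSmoothPath (Ioo (-r) r) (fun t => w (p + t • e)) ∧
      ∀ t ∈ Ioo (-r) r, ∀ x, w (p + t • e) x ∈ U := by
  obtain ⟨hΩ, hsmooth, hcompact⟩ := hw
  obtain ⟨K, -, hKU, hK⟩ := hcompact p hp
  filter_upwards [eventually_forall_add_smul_of_eventually (hK.and (hΩ.mem_nhds hp)) e,
    self_mem_nhdsWithin] with r hr hr0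
  exact ⟨⟨isOpen_Ioo, ⟨neg_lt_zero.2 hr0, hr0⟩,
    hsmooth.comp (f := fun q : ℝ × ℝ => (p + q.1 • e, q.2)) (ContDiff.contDiffOn (by fun_prop))
      fun q hq => ⟨(hr q.1 hq.1).2, mem_univ _⟩⟩, fun t ht x => hKU ((hr t ht).1 x)⟩

theorem IsVariationalDerivative.eventually_isTestPath (hF : IsVariationalDerivative U F dF)
    (hw : IsSmoothFamily U Ω w) (hp : p ∈ Ω) (e : Fin k → ℝ) :
    ∀ᶠ r in 𝓝[>] (0 : ℝ), IsTestPath (Ioo (-r) r) fun t => dF (w (p + t • e)) := by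
  obtain ⟨hsmooth, hsupport, -⟩ := hF k Ω w hw
  obtain ⟨R, hR⟩ := hsupport p hp
  filter_upwards [eventually_forall_add_smul_of_eventually (hR.and (hw.1.mem_nhds hp)) e,
    self_mem_nhdsWithin] with r hr hr0
  exact ⟨⟨isOpen_Ioo, ⟨neg_lt_zero.2 hr0, hr0⟩,
    hsmooth.comp (f := fun q : ℝ × ℝ => (p + q.1 • e, q.2)) (ContDiff.contDiffOn (by fun_prop))
      fun q hq => ⟨(hr q.1 hq.1).2, mem_univ _⟩⟩, Icc (-R) R, isCompact_Icc,
    fun t ht x hx => (hr t ht).1 x (not_le.1 fun h => hx (abs_le.1 h))⟩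

theorem IsVariationalDerivative.differentiableOn_integral (hF : IsVariationalDerivative U F dF)
    (hw : IsSmoothFamily U Ω w) {X : ℝ → Fin n → ℝ} (hX : ContDiff ℝ ∞ X) :
    DifferentiableOn ℝ (fun p => ∫ x, ∑ j, dF (w p) x j * X x j) Ω := fun p hp => by
  obtain ⟨hsmooth, hsupport, -⟩ := hF k Ω w hw
  obtain ⟨R, hR⟩ := hsupport p hp
  have hdot : ContDiffOn ℝ 1 (uncurry fun p x => ∑ j, dF (w p) x j * X x j) (Ω ×ˢ univ) :=
    (ContDiffOn.sum fun j _ => (contDiffOn_pi.1 hsmooth j).mul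
      ((contDiff_pi.1 hX j).comp contDiff_snd).contDiffOn).of_le (by exact_mod_cast le_top)
  have hzero : ∀ᶠ q in 𝓝 p, ∀ x ∉ Icc (-R) R, ∑ j, dF (w q) x j * X x j = 0 := by
    filter_upwards [hR] with q hq x hx
    simp [hq x (not_le.1 fun h => hx (abs_le.1 h))]
  simpa using (hasFDerivAt_integral_smul_of_contDiffOn (μ := volume) (κ := fun _ => 1)
    measurable_const (C := 1) (by simp) hw.1 hdot hp isCompact_Icc
    hzero).2.differentiableAt.differentiableWithinAt

theorem isVariationalDerivative_linear {ρ : ℝ → Fin n → ℝ} (hρ : IsTest ρ) :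
    IsVariationalDerivative U (fun u => ∫ x, ∑ j, ρ x j * u x j) (fun _ => ρ) := by
  intro k Ω w hw
  refine ⟨(hρ.contDiff.comp contDiff_snd).contDiffOn, fun p _ => ?_, fun p hp e => ?_⟩
  · obtain ⟨R, hR⟩ := hρ.hasCompactSupport.isCompact.isBounded.exists_norm_le
    exact ⟨R, Eventually.of_forall fun _ x hx =>
      image_eq_zero_of_notMem_tsupport fun h => (hR x h).not_gt hx⟩
  · obtain ⟨r, hpath, -⟩ := (hw.eventually_isSmoothPath hp e).exists
    have hconst : IsTestPath (Ioo (-r) r) fun _ => ρ :=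
      ⟨⟨hpath.isOpen, hpath.zero_mem, (hρ.contDiff.comp contDiff_snd).contDiffOn⟩,
        tsupport ρ, hρ.hasCompactSupport, fun _ _ _ hx => image_eq_zero_of_notMem_tsupport hx⟩
    refine (hconst.dot hpath).hasDerivAt_integral.congr_deriv
      (integral_congr_ae (ae_of_all _ fun x => ?_))
    have hderiv := fun j => hpath.hasDerivAt_apply j x
    simp only [(hderiv _).deriv]
    exact (HasDerivAt.fun_sum fun j _ => (hderiv j).const_mul (ρ x j)).deriv

/-- Smooth bounded functions on the line: the directions in which fields are varied. -/
structure IsBoundedSmooth {E : Type*} [NormedAddCommGroup E] [NormedSpace ℝ E] (V : ℝ → E) :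
    Prop where
  contDiff : ContDiff ℝ ∞ V
  exists_norm_le : ∃ C, ∀ x, ‖V x‖ ≤ C

theorem IsTest.isBoundedSmooth {E : Type*} [NormedAddCommGroup E] [NormedSpace ℝ E] {a : ℝ → E}
    (ha : IsTest a) : IsBoundedSmooth a :=
  ⟨ha.contDiff, ha.hasCompactSupport.exists_bound_of_continuous ha.contDiff.continuous⟩

theorem IsBoundedSmooth.add {E : Type*} [NormedAddCommGroup E] [NormedSpace ℝ E] {V W : ℝ → E}
    (hV : IsBoundedSmooth V) (hW : IsBoundedSmooth W) : IsBoundedSmooth (V + W) := by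
  obtain ⟨hV, C, hC⟩ := hV
  obtain ⟨hW, D, hD⟩ := hW
  exact ⟨hV.add hW, C + D, fun x => (norm_add_le _ _).trans (add_le_add (hC x) (hD x))⟩

/-- The variation `u + ∑ᵢ pᵢ Vᵢ` of a field. -/
def variation (u : ℝ → Fin n → ℝ) (V : Fin k → ℝ → Fin n → ℝ) (p : Fin k → ℝ) : ℝ → Fin n → ℝ :=
  u + ∑ i, p i • V i

theorem variation_add_smul_single (u : ℝ → Fin n → ℝ) (V : Fin k → ℝ → Fin n → ℝ) (p : Fin k → ℝ)
    (t : ℝ) (i : Fin k) :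
    variation u V (p + t • Pi.single i 1) = variation u V p + t • V i := by
  simp only [variation, Pi.add_apply, Pi.smul_apply, add_smul, Finset.sum_add_distrib, add_assoc,
    Pi.single_apply, smul_eq_mul, mul_ite, mul_one, mul_zero, ite_smul, zero_smul,
    Finset.sum_ite_eq', Finset.mem_univ, if_true]

theorem variation_zero (u : ℝ → Fin n → ℝ) (V : Fin k → ℝ → Fin n → ℝ) : variation u V 0 = u := by
  simp [variation]

variable {u : ℝ → Fin n → ℝ} {V : Fin k → ℝ → Fin n → ℝ} {X Y : ℝ → Fin n → ℝ}

theorem exists_isSmoothFamily_variation (hU : IsOpen U) (hu : IsFieldIn U u)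
    (hV : ∀ i, IsBoundedSmooth (V i)) :
    ∃ r > 0, IsSmoothFamily U (Metric.ball 0 r) (variation u V) := by
  obtain ⟨hu, K, hK, hKU, huK⟩ := hu
  choose C hC using fun i => (hV i).exists_norm_le
  have hsmooth := fun i => (hV i).contDiff
  obtain ⟨δ, hδ, hδU⟩ := hK.exists_cthickening_subset_open hU hKU
  have hpos : 0 < ∑ i, C i + 1 :=
    add_pos_of_nonneg_of_pos (Finset.sum_nonneg fun i _ => (norm_nonneg _).trans (hC i 0)) one_pos
  refine ⟨δ / (∑ i, C i + 1), div_pos hδ hpos, Metric.isOpen_ball, ?_, fun p hp =>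
    ⟨Metric.cthickening δ K, hK.cthickening, hδU, ?_⟩⟩
  · have : ContDiff ℝ ∞ fun q : (Fin k → ℝ) × ℝ => u q.2 + ∑ i, q.1 i • V i q.2 := by fun_prop
    simpa [variation] using this.contDiffOn
  · filter_upwards [Metric.isOpen_ball.mem_nhds hp] with q hq x
    rw [mem_ball_zero_iff, lt_div_iff₀ hpos] at hq
    refine Metric.mem_cthickening_of_dist_le _ (u x) δ K (huK x) ?_
    calc dist (variation u V q x) (u x) = ‖∑ i, q i • V i x‖ := by simp [variation, dist_eq_norm]
      _ ≤ ∑ i, ‖q‖ * C i := norm_sum_le_of_le _ fun i _ => by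
        rw [norm_smul]
        exact mul_le_mul (norm_le_pi_norm q i) (hC i x) (norm_nonneg _) (norm_nonneg _)
      _ ≤ ‖q‖ * (∑ i, C i + 1) := by
        rw [← Finset.mul_sum]
        exact mul_le_mul_of_nonneg_left (le_add_of_nonneg_right zero_le_one) (norm_nonneg q)
      _ ≤ δ := hq.le

theorem eventually_isSmoothPath_line (hU : IsOpen U) (hu : IsFieldIn U u)
    (hX : IsBoundedSmooth X) :
    ∀ᶠ r in 𝓝[>] (0 : ℝ), IsSmoothPath (Ioo (-r) r) (fun t => u + t • X) ∧
      ∀ t ∈ Ioo (-r) r, ∀ x, (u + t • X) x ∈ U := by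
  obtain ⟨r, hr, hfam⟩ :=
    exists_isSmoothFamily_variation (V := fun _ : Fin 1 => X) hU hu fun _ => hX
  simpa only [variation_add_smul_single, variation_zero] using
    hfam.eventually_isSmoothPath (Metric.mem_ball_self hr) (Pi.single 0 1)

namespace IsVariationalDerivative

theorem eventually_isTestPath_line (hF : IsVariationalDerivative U F dF) (hU : IsOpen U)
    (hu : IsFieldIn U u) (hX : IsBoundedSmooth X) :
    ∀ᶠ r in 𝓝[>] (0 : ℝ), IsTestPath (Ioo (-r) r) fun t => dF (u + t • X) := by
  obtain ⟨r, hr, hfam⟩ :=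
    exists_isSmoothFamily_variation (V := fun _ : Fin 1 => X) hU hu fun _ => hX
  simpa only [variation_add_smul_single, variation_zero] using
    hF.eventually_isTestPath hfam (Metric.mem_ball_self hr) (Pi.single 0 1)

theorem isTest (hF : IsVariationalDerivative U F dF) (hU : IsOpen U) (hu : IsFieldIn U u) :
    IsTest (dF u) := by
  obtain ⟨r, hr⟩ :=
    (hF.eventually_isTestPath_line hU hu (X := 0) ⟨contDiff_const, 0, by simp⟩).exists
  simpa using hr.isTest_slice hr.zero_mem

theorem isTest_timeDeriv (hF : IsVariationalDerivative U F dF) (hU : IsOpen U)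
    (hu : IsFieldIn U u) (hX : IsBoundedSmooth X) : IsTest (timeDeriv fun t => dF (u + t • X)) :=
  let ⟨_, hr⟩ := (hF.eventually_isTestPath_line hU hu hX).exists
  hr.isTest_timeDeriv

theorem hasDerivAt_variation (hF : IsVariationalDerivative U F dF)
    (hw : IsSmoothFamily U Ω (variation u V)) (hp : p ∈ Ω) (i : Fin k) :
    HasDerivAt (fun s : ℝ => F (variation u V (p + s • Pi.single i 1)))
      (∫ x, ∑ j, dF (variation u V p) x j * V i x j) 0 := by
  refine ((hF k Ω _ hw).2.2 p hp (Pi.single i 1)).congr_deriv ?_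
  simp [variation_add_smul_single]

theorem hasDerivAt_variation_sub (hF : IsVariationalDerivative U F dF)
    (hw : IsSmoothFamily U Ω (variation u V)) (hp : p ∈ Ω) (i : Fin k) (a : ℝ) :
    HasDerivAt (fun s : ℝ => F (variation u V (p + (s - a) • Pi.single i 1)))
      (∫ x, ∑ j, dF (variation u V p) x j * V i x j) a :=
  .comp_sub_const a a (sub_self a ▸ hF.hasDerivAt_variation hw hp i)

theorem deriv_integral_line (hF : IsVariationalDerivative U F dF) (hU : IsOpen U)
    (hu : IsFieldIn U u) (hX : IsBoundedSmooth X) (hY : ContDiff ℝ ∞ Y) :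
    deriv (fun t : ℝ => ∫ x, ∑ j, dF (u + t • X) x j * Y x j) 0 =
      ∫ x, ∑ j, timeDeriv (fun t => dF (u + t • X)) x j * Y x j := by
  obtain ⟨r, hr⟩ := (hF.eventually_isTestPath_line hU hu hX).exists
  have hconst : IsSmoothPath (Ioo (-r) r) fun _ => Y :=
    ⟨hr.isOpen, hr.zero_mem, (hY.comp contDiff_snd).contDiffOn⟩
  refine (hr.dot hconst).hasDerivAt_integral.deriv.trans
    (integral_congr_ae (ae_of_all _ fun x => ?_))
  exact (HasDerivAt.fun_sum fun j _ => (hr.hasDerivAt_apply j x).mul_const (Y x j)).deriv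

theorem integral_second_variation_symmetric (hF : IsVariationalDerivative U F dF) (hU : IsOpen U)
    (hu : IsFieldIn U u) (hX : IsBoundedSmooth X) (hY : IsBoundedSmooth Y) :
    ∫ x, ∑ j, timeDeriv (fun t => dF (u + t • X)) x j * Y x j =
      ∫ x, ∑ j, timeDeriv (fun t => dF (u + t • Y)) x j * X x j := by
  obtain ⟨r, hr, hfam⟩ := exists_isSmoothFamily_variation (V := ![X, Y]) hU hu
    (Fin.forall_fin_two.2 ⟨hX, hY⟩)
  have hparam : ContDiff ℝ ∞ fun q : ℝ × ℝ => ![q.1, q.2] :=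
    contDiff_pi.2 (Fin.forall_fin_two.2 ⟨contDiff_fst, contDiff_snd⟩)
  have hdiff : ∀ {Z : ℝ → Fin n → ℝ}, IsBoundedSmooth Z →
      DifferentiableOn ℝ
        (fun q : ℝ × ℝ => ∫ x, ∑ j, dF (variation u ![X, Y] ![q.1, q.2]) x j * Z x j)
        ((fun q => ![q.1, q.2]) ⁻¹' Metric.ball 0 r) := fun hZ =>
    (hF.differentiableOn_integral hfam hZ.contDiff).comp
      (hparam.differentiable (by simp)).differentiableOn (mapsTo_preimage _ _)
  have hfst : ∀ s t x : ℝ, (![s, t] : Fin 2 → ℝ) + (x - s) • Pi.single 0 1 = ![x, t] :=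
    fun s t x => by ext i; fin_cases i <;> simp
  have hsnd : ∀ s t x : ℝ, (![s, t] : Fin 2 → ℝ) + (x - t) • Pi.single 1 1 = ![s, x] :=
    fun s t x => by ext i; fin_cases i <;> simp
  have hswap := deriv_swap_of_hasDerivAt_partial (s := 0) (t := 0)
    (Φ := fun s t => F (variation u ![X, Y] ![s, t]))
    (A := fun s t => ∫ x, ∑ j, dF (variation u ![X, Y] ![s, t]) x j * X x j)
    (B := fun s t => ∫ x, ∑ j, dF (variation u ![X, Y] ![s, t]) x j * Y x j)
    (Metric.isOpen_ball.preimage hparam.continuous)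
    (fun q hq => by simpa only [hfst] using! hF.hasDerivAt_variation_sub hfam hq 0 q.1)
    (fun q hq => by simpa only [hsnd] using! hF.hasDerivAt_variation_sub hfam hq 1 q.2)
    (hdiff hX) (hdiff hY) (by simpa [← Matrix.zero_empty] using hr)
  simp only [variation, Fin.sum_univ_two, Matrix.cons_val_zero, Matrix.cons_val_one, zero_smul,
    zero_add, add_zero] at hswap
  rw [hF.deriv_integral_line hU hu hX hY.contDiff, hF.deriv_integral_line hU hu hY hX.contDiff]
    at hswap
  exact hswap.symm

end IsVariationalDerivative

end Variations

section HamiltonianCriterion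

variable {n : ℕ} {U : Set (Fin n → ℝ)} {g : (Fin n → ℝ) → Matrix (Fin n) (Fin n) ℝ}
  {Γ : (Fin n → ℝ) → Fin n → Fin n → Fin n → ℝ} {f : (Fin n → ℝ) → Fin n → ℝ} {ε : ℝ}
  {u φ ψ χ V : ℝ → Fin n → ℝ}

/-- Skew-symmetry of an operator on test covectors. -/
def IsSkewOn (U : Set (Fin n → ℝ)) (P : FieldOperator n) : Prop :=
  ∀ u φ ψ, IsFieldIn U u → IsTest φ → IsTest ψ → pairing P u φ ψ = -pairing P u ψ φ

/-- The derivative of `∫ φᵢ Pⁱʲ ψⱼ dx` along `P χ`, for `P = weaklyNonlocal g Γ f ε`. -/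
noncomputable def jacobiTerm (g : (Fin n → ℝ) → Matrix (Fin n) (Fin n) ℝ)
    (Γ : (Fin n → ℝ) → Fin n → Fin n → Fin n → ℝ) (f : (Fin n → ℝ) → Fin n → ℝ) (ε : ℝ)
    (u φ ψ χ : ℝ → Fin n → ℝ) : ℝ :=
  linearPairing g Γ f ε u (weaklyNonlocal g Γ f ε u χ) φ ψ

/-- Sum over the cyclic permutations of three arguments, as in the Jacobi identity. -/
def cyclicSum {α β : Type*} [Add β] (T : α → α → α → β) (a b c : α) : β :=
  T a b c + T b c a + T c a b

/-- The Jacobi identity of `weaklyNonlocal g Γ f ε` at the field `u`, on test covectors. -/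
def JacobiAt (g : (Fin n → ℝ) → Matrix (Fin n) (Fin n) ℝ)
    (Γ : (Fin n → ℝ) → Fin n → Fin n → Fin n → ℝ) (f : (Fin n → ℝ) → Fin n → ℝ) (ε : ℝ)
    (u : ℝ → Fin n → ℝ) : Prop :=
  ∀ φ ψ χ, IsTest φ → IsTest ψ → IsTest χ → cyclicSum (jacobiTerm g Γ f ε u) φ ψ χ = 0

namespace SmoothCoefficients

theorem isBoundedSmooth_weaklyNonlocal (hc : SmoothCoefficients U g Γ f) (hu : IsFieldIn U u)
    (hψ : IsTest ψ) : IsBoundedSmooth (weaklyNonlocal g Γ f ε u ψ) := by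
  refine (hc.isTest_hydroOperator hu.isSmoothIn hψ).isBoundedSmooth.add
    ⟨(hc.contDiff_tailOperator hu.isSmoothIn hψ).const_smul ε, ?_⟩
  have hint := (hc.isTest_contract hu.isSmoothIn hψ).integrable
  obtain ⟨-, K, hK, hKU, huK⟩ := hu
  obtain ⟨C, hC⟩ := hK.exists_bound_of_continuousOn
    ((contDiffOn_pi.2 hc.vector).continuousOn.mono hKU)
  refine ⟨|ε| * ((∫ y, |contract f u ψ y|) * C), fun x => ?_⟩
  have htail : (ε • tailOperator f) u ψ x = ε • dxInv (contract f u ψ) x • f (u x) :=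
    funext fun i => congrArg (ε * ·) (mul_comm _ _)
  rw [htail, norm_smul, norm_smul]
  exact mul_le_mul_of_nonneg_left (mul_le_mul (abs_dxInv_le hint x) (hC _ (huK x))
    (norm_nonneg _) (integral_nonneg fun y => abs_nonneg _)) (abs_nonneg ε)

theorem hasDerivAt_poissonBracket (hc : SmoothCoefficients U g Γ f)
    {F G : (ℝ → Fin n → ℝ) → ℝ} {dF dG : (ℝ → Fin n → ℝ) → ℝ → Fin n → ℝ}
    (hF : IsVariationalDerivative U F dF) (hG : IsVariationalDerivative U G dG)
    (hu : IsFieldIn U u) (hV : IsBoundedSmooth V) :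
    HasDerivAt (fun s : ℝ => poissonBracket (weaklyNonlocal g Γ f ε) dF dG (u + s • V))
      (pairing (weaklyNonlocal g Γ f ε) u (timeDeriv fun t => dF (u + t • V)) (dG u) +
        pairing (weaklyNonlocal g Γ f ε) u (dF u) (timeDeriv fun t => dG (u + t • V)) +
        linearPairing g Γ f ε u V (dF u) (dG u)) 0 := by
  obtain ⟨r, ⟨hw, hwU⟩, hΦ, hΨ⟩ := ((eventually_isSmoothPath_line hc.isOpen hu hV).and
    ((hF.eventually_isTestPath_line hc.isOpen hu hV).and
      (hG.eventually_isTestPath_line hc.isOpen hu hV))).exists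
  have hvelocity : (timeDeriv fun t => u + t • V) = V := funext fun x =>
    (((hasDerivAt_id (0 : ℝ)).smul_const (V x)).const_add (u x)).deriv.trans (one_smul ℝ (V x))
  have hpairing := hc.hasDerivAt_pairing (ε := ε) hw hwU hΦ hΨ
  rw [hvelocity] at hpairing
  simpa only [zero_smul, add_zero] using! hpairing

theorem hasDerivAt_poissonBracket_linear (hc : SmoothCoefficients U g Γ f) (hu : IsFieldIn U u)
    (hφ : IsTest φ) (hψ : IsTest ψ) (hχ : IsTest χ) :
    HasDerivAt (fun s : ℝ => poissonBracket (weaklyNonlocal g Γ f ε) (fun _ => φ) (fun _ => ψ)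
      (u + s • weaklyNonlocal g Γ f ε u χ)) (jacobiTerm g Γ f ε u φ ψ χ) 0 := by
  refine (hc.hasDerivAt_poissonBracket (isVariationalDerivative_linear hφ)
    (isVariationalDerivative_linear hψ) hu (hc.isBoundedSmooth_weaklyNonlocal hu hχ)).congr_deriv ?_
  have hconst : ∀ ρ : ℝ → Fin n → ℝ, (timeDeriv fun _ => ρ) = 0 := fun ρ =>
    funext fun x => deriv_const 0 (ρ x)
  simp [hconst, jacobiTerm, pairing, weaklyNonlocal, hydroOperator, tailOperator, dxInv]

theorem isSkewOn_and_jacobiAt_of_isHamiltonian (hc : SmoothCoefficients U g Γ f)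
    (hP : IsHamiltonian U (weaklyNonlocal g Γ f ε)) :
    IsSkewOn U (weaklyNonlocal g Γ f ε) ∧ ∀ u, IsFieldIn U u → JacobiAt g Γ f ε u := by
  obtain ⟨hskew, hjac⟩ := hP
  refine ⟨fun u φ ψ hu hφ hψ => hskew _ _ _ _ (isVariationalDerivative_linear hφ)
    (isVariationalDerivative_linear hψ) u hu, fun u hu φ ψ χ hφ hψ hχ => ?_⟩
  obtain ⟨a, b, c, ha, hb, hc', habc⟩ := hjac _ _ _ _ _ _ (isVariationalDerivative_linear hφ)
    (isVariationalDerivative_linear hψ) (isVariationalDerivative_linear hχ) u hu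
  rw [cyclicSum, ← ha.unique (hc.hasDerivAt_poissonBracket_linear hu hφ hψ hχ),
    ← hb.unique (hc.hasDerivAt_poissonBracket_linear hu hψ hχ hφ),
    ← hc'.unique (hc.hasDerivAt_poissonBracket_linear hu hχ hφ hψ), habc]

/-- In the Jacobi identity for nonlinear functionals, the derivatives of the variational
derivatives cancel in pairs because second variations are symmetric. -/
theorem isHamiltonian_of_isSkewOn_of_jacobiAt (hc : SmoothCoefficients U g Γ f)
    (hskew : IsSkewOn U (weaklyNonlocal g Γ f ε))
    (hjac : ∀ u, IsFieldIn U u → JacobiAt g Γ f ε u) :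
    IsHamiltonian U (weaklyNonlocal g Γ f ε) := by
  have hU := hc.isOpen
  refine ⟨fun F G dF dG hF hG u hu => hskew u _ _ hu (hF.isTest hU hu) (hG.isTest hU hu),
    fun F G H dF dG dH hF hG hH u hu => ?_⟩
  have tF := hF.isTest hU hu
  have tG := hG.isTest hU hu
  have tH := hH.isTest hU hu
  have vF := hc.isBoundedSmooth_weaklyNonlocal (ε := ε) hu tF
  have vG := hc.isBoundedSmooth_weaklyNonlocal (ε := ε) hu tG
  have vH := hc.isBoundedSmooth_weaklyNonlocal (ε := ε) hu tH
  refine ⟨_, _, _, hc.hasDerivAt_poissonBracket hF hG hu vH,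
    hc.hasDerivAt_poissonBracket hG hH hu vF, hc.hasDerivAt_poissonBracket hH hF hu vG, ?_⟩
  rw [hskew u (dF u) _ hu tF (hG.isTest_timeDeriv hU hu vH),
    hskew u (dG u) _ hu tG (hH.isTest_timeDeriv hU hu vF),
    hskew u (dH u) _ hu tH (hF.isTest_timeDeriv hU hu vG)]
  have sF := hF.integral_second_variation_symmetric hU hu vH vG
  have sG := hG.integral_second_variation_symmetric hU hu vF vH
  have sH := hH.integral_second_variation_symmetric hU hu vG vF
  have hj := hjac u hu _ _ _ tF tG tH
  simp only [cyclicSum, jacobiTerm] at hj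
  simp only [pairing]
  linear_combination hj + sF + sG + sH

theorem isHamiltonian_weaklyNonlocal_iff (hc : SmoothCoefficients U g Γ f) :
    IsHamiltonian U (weaklyNonlocal g Γ f ε) ↔
      IsSkewOn U (weaklyNonlocal g Γ f ε) ∧ ∀ u, IsFieldIn U u → JacobiAt g Γ f ε u :=
  ⟨hc.isSkewOn_and_jacobiAt_of_isHamiltonian,
    fun ⟨hskew, hjac⟩ => hc.isHamiltonian_of_isSkewOn_of_jacobiAt hskew hjac⟩

end SmoothCoefficients

end HamiltonianCriterion

section Skewness

variable {n : ℕ} {U : Set (Fin n → ℝ)} {g : (Fin n → ℝ) → Matrix (Fin n) (Fin n) ℝ}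
  {Γ : (Fin n → ℝ) → Fin n → Fin n → Fin n → ℝ} {f : (Fin n → ℝ) → Fin n → ℝ} {ε : ℝ}
  {h : (Fin n → ℝ) → ℝ} {u φ ψ : ℝ → Fin n → ℝ} {u₀ : Fin n → ℝ}

theorem fderiv_apply_eq_sum_partialDeriv (h : (Fin n → ℝ) → ℝ) (u v : Fin n → ℝ) :
    fderiv ℝ h u v = ∑ k, partialDeriv h k u * v k := by
  conv_lhs => rw [pi_eq_sum_univ' v]
  simp only [map_sum, map_smul, smul_eq_mul, partialDeriv, mul_comm]

theorem contDiffOn_partialDeriv (hU : IsOpen U) (hh : ContDiffOn ℝ ∞ h U) (k : Fin n) :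
    ContDiffOn ℝ ∞ (partialDeriv h k) U :=
  (hh.fderiv_of_isOpen hU le_rfl).clm_apply contDiffOn_const

theorem hasDerivAt_apply_of_contDiff (hψ : ContDiff ℝ ∞ ψ) (k : Fin n) (x : ℝ) :
    HasDerivAt (fun y => ψ y k) (deriv (fun y => ψ y k) x) x :=
  ((contDiff_infty_iff_deriv.1 (contDiff_pi.1 hψ k)).1 x).hasDerivAt

theorem IsSmoothIn.hasDerivAt_comp (hu : IsSmoothIn U u) (hU : IsOpen U) (hh : ContDiffOn ℝ ∞ h U)
    (x : ℝ) : HasDerivAt (fun y => h (u y))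
      (∑ k, partialDeriv h k (u x) * deriv (fun y => u y k) x) x := by
  rw [← fderiv_apply_eq_sum_partialDeriv (v := fun k => deriv (fun y => u y k) x)]
  exact ((hh.differentiableOn (by simp)).hasFDerivAt (hU.mem_nhds (hu.mem x))).comp_hasDerivAt x
    (hasDerivAt_pi.2 fun k => hasDerivAt_apply_of_contDiff hu.contDiff k x)

/-- The pointwise form of the skew-symmetry of `gⁱʲ ∂ₓ + Γⁱʲₖ uᵏₓ`. -/
structure SkewRelations (U : Set (Fin n → ℝ)) (g : (Fin n → ℝ) → Matrix (Fin n) (Fin n) ℝ)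
    (Γ : (Fin n → ℝ) → Fin n → Fin n → Fin n → ℝ) : Prop where
  symm : ∀ u ∈ U, ∀ i j, g u i j = g u j i
  compat : ∀ u ∈ U, ∀ i j k, partialDeriv (fun v => g v i j) k u = Γ u i j k + Γ u j i k

theorem SkewRelations.dot_hydroOperator_add_swap (hs : SkewRelations U g Γ)
    (hc : SmoothCoefficients U g Γ f) (hu : IsSmoothIn U u) (hφ : ContDiff ℝ ∞ φ)
    (hψ : ContDiff ℝ ∞ ψ) (x : ℝ) :
    HasDerivAt (fun y => ∑ i, ∑ j, g (u y) i j * (φ y i * ψ y j))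
      ((∑ i, φ x i * hydroOperator g Γ u ψ x i) + ∑ i, ψ x i * hydroOperator g Γ u φ x i) x := by
  refine (HasDerivAt.fun_sum fun i _ => HasDerivAt.fun_sum fun j _ =>
    (hu.hasDerivAt_comp hc.isOpen (hc.metric i j) x).fun_mul
      ((hasDerivAt_apply_of_contDiff hφ i x).fun_mul
        (hasDerivAt_apply_of_contDiff hψ j x))).congr_deriv ?_
  simp only [hydroOperator, Finset.mul_sum]
  rw [Finset.sum_comm (f := fun i j => ψ x i * _)]
  simp only [← Finset.sum_add_distrib]
  refine Finset.sum_congr rfl fun i _ => Finset.sum_congr rfl fun j _ => ?_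
  simp only [hs.compat _ (hu.mem x), hs.symm _ (hu.mem x) j i, add_mul, Finset.sum_add_distrib,
    ← Finset.sum_mul]
  ring

theorem SmoothCoefficients.isTest_sum_sum_metric_mul (hc : SmoothCoefficients U g Γ f)
    (hu : IsSmoothIn U u) (hφ : IsTest φ) (hψ : IsTest ψ) :
    IsTest fun x => ∑ i, ∑ j, g (u x) i j * (φ x i * ψ x j) :=
  .sum fun i _ => .sum fun j _ =>
    ((hφ.apply i).mul_right (hψ.apply j).contDiff).mul_left (hu.comp (hc.metric i j))

theorem isSkewOn_weaklyNonlocal_iff (hc : SmoothCoefficients U g Γ f) :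
    IsSkewOn U (weaklyNonlocal g Γ f ε) ↔
      ∀ u φ ψ : ℝ → Fin n → ℝ, IsFieldIn U u → IsTest φ → IsTest ψ →
        ∫ x, ((∑ i, φ x i * hydroOperator g Γ u ψ x i) +
          ∑ i, ψ x i * hydroOperator g Γ u φ x i) = 0 := by
  refine forall₃_congr fun u φ ψ => forall₃_congr fun hu hφ hψ => ?_
  have hu := hu.isSmoothIn
  rw [hc.pairing_weaklyNonlocal hu hφ hψ, hc.pairing_weaklyNonlocal hu hψ hφ,
    integral_mul_dxInv_swap (hc.isTest_contract hu hφ).integrable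
      (hc.isTest_contract hu hψ).integrable,
    integral_add (hφ.dot (hc.isTest_hydroOperator hu hψ).contDiff).integrable
      (hψ.dot (hc.isTest_hydroOperator hu hφ).contDiff).integrable]
  constructor <;> intro h <;> linear_combination h

/-- The test covector `α eᵢ`. -/
def singleTest (α : ℝ → ℝ) (i : Fin n) (x : ℝ) : Fin n → ℝ := Pi.single i (α x)

theorem singleTest_apply (α : ℝ → ℝ) (i j : Fin n) :
    (fun x => singleTest α i x j) = fun x => (Pi.single i 1 : Fin n → ℝ) j * α x := by
  funext x
  rcases eq_or_ne j i with rfl | hj <;> simp [singleTest, *]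

theorem IsTest.singleTest {α : ℝ → ℝ} (hα : IsTest α) (i : Fin n) : IsTest (singleTest α i) :=
  .pi fun j => singleTest_apply α i j ▸ hα.mul_left contDiff_const

theorem deriv_singleTest (α : ℝ → ℝ) (i j : Fin n) (x : ℝ) :
    deriv (fun y => singleTest α i y j) x = singleTest (deriv α) i x j := by
  rw [singleTest_apply, deriv_const_mul_field, congrFun (singleTest_apply (deriv α) i j) x]

theorem sum_mul_singleTest (c : Fin n → ℝ) (α : ℝ → ℝ) (i : Fin n) (x : ℝ) :
    ∑ j, c j * singleTest α i x j = c i * α x := by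
  simp [singleTest, Pi.single_apply]

theorem sum_singleTest_mul (c : Fin n → ℝ) (α : ℝ → ℝ) (i : Fin n) (x : ℝ) :
    ∑ j, singleTest α i x j * c j = α x * c i := by
  simp [singleTest, Pi.single_apply]

theorem hydroOperator_singleTest (β : ℝ → ℝ) (i j : Fin n) (x : ℝ) :
    hydroOperator g Γ u (singleTest β j) x i =
      g (u x) i j * deriv β x + (∑ k, Γ (u x) i j k * deriv (fun y => u y k) x) * β x := by
  simp only [hydroOperator, deriv_singleTest, Finset.sum_add_distrib, ← Finset.sum_mul]
  rw [sum_mul_singleTest, sum_mul_singleTest fun j => ∑ k, Γ (u x) i j k * _]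

theorem eq_zero_of_forall_integral_isTest_mul_eq_zero {a : ℝ → ℝ} (ha : Continuous a)
    (hzero : ∀ α, IsTest α → ∫ x, α x * a x = 0) (x : ℝ) : a x = 0 :=
  congrFun ((ha.ae_eq_iff_eq volume continuous_const).1
    (ae_eq_zero_of_integral_contDiff_smul_eq_zero ha.locallyIntegrable
      fun α hα hα' => hzero α ⟨hα, hα'⟩)) x

theorem exists_isTest_eventuallyEq_one : ∃ α : ℝ → ℝ, IsTest α ∧ α =ᶠ[𝓝 0] fun _ => 1 :=
  let b : ContDiffBump (0 : ℝ) := ⟨1, 2, by simp, by simp⟩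
  ⟨b, ⟨b.contDiff, b.hasCompactSupport⟩, b.eventuallyEq_one⟩

theorem exists_isFieldIn_hasDerivAt (hU : IsOpen U) (hu₀ : u₀ ∈ U) (v : Fin n → ℝ) :
    ∃ u, IsFieldIn U u ∧ u 0 = u₀ ∧ HasDerivAt u v 0 := by
  obtain ⟨δ, hδ, hδU⟩ := Metric.nhds_basis_closedBall.mem_iff.1 (hU.mem_nhds hu₀)
  obtain ⟨s, hs, hsδ⟩ : ∃ s > 0, s * (‖v‖ + 1) = δ :=
    ⟨δ / (‖v‖ + 1), by positivity, div_mul_cancel₀ δ (by positivity)⟩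
  refine ⟨fun x => u₀ + (s * Real.sin (x / s)) • v, ⟨by fun_prop, Metric.closedBall u₀ δ,
    isCompact_closedBall _ _, hδU, fun x => ?_⟩, by simp, ?_⟩
  · rw [mem_closedBall_iff_norm, add_sub_cancel_left, norm_smul, norm_mul, Real.norm_eq_abs,
      Real.norm_eq_abs, abs_of_pos hs, mul_assoc, ← hsδ]
    refine mul_le_mul_of_nonneg_left ?_ hs.le
    exact (mul_le_of_le_one_left (norm_nonneg v) (Real.abs_sin_le_one _)).trans (by simp)
  · have hsin : HasDerivAt (fun x => s * Real.sin (x / s)) 1 0 :=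
      (((hasDerivAt_id (0 : ℝ)).div_const s).sin.const_mul s).congr_deriv (by simp [hs.ne'])
    simpa using (hsin.smul_const v).const_add u₀

theorem IsSkewOn.metric_symbol_relation (hskew : IsSkewOn U (weaklyNonlocal g Γ f ε))
    (hc : SmoothCoefficients U g Γ f) (hu : IsFieldIn U u) {β : ℝ → ℝ} (hβ : IsTest β)
    (i j : Fin n) (x : ℝ) :
    (g (u x) j i - g (u x) i j) * deriv β x + (∑ k, (Γ (u x) i j k + Γ (u x) j i k -
      partialDeriv (fun v => g v i j) k (u x)) * deriv (fun y => u y k) x) * β x = 0 := by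
  have hus := hu.isSmoothIn
  have hg : ∀ i j, ContDiff ℝ ∞ fun x => g (u x) i j := fun i j => hus.comp (hc.metric i j)
  have hk : ContDiff ℝ ∞ fun x => ∑ k, (Γ (u x) i j k + Γ (u x) j i k -
      partialDeriv (fun v => g v i j) k (u x)) * deriv (fun y => u y k) x :=
    ContDiff.sum fun k _ => (((hus.comp (hc.symbol i j k)).add (hus.comp (hc.symbol j i k))).sub
      (hus.comp (contDiffOn_partialDeriv hc.isOpen (hc.metric i j) k))).mul
        (contDiff_deriv_apply hus.contDiff k)
  have hsmooth := (((hg j i).sub (hg i j)).mul hβ.deriv.contDiff).add (hk.mul hβ.contDiff)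
  refine eq_zero_of_forall_integral_isTest_mul_eq_zero hsmooth.continuous (fun α hα => ?_) x
  have htotal := (hα.mul_right hβ.contDiff).mul_left (hg i j)
  have hzero := (isSkewOn_weaklyNonlocal_iff hc).1 hskew u _ _ hu (hβ.singleTest i)
    (hα.singleTest j)
  have hint := ((hβ.singleTest i).dot (hc.isTest_hydroOperator hus (hα.singleTest j)).contDiff).add
    ((hα.singleTest j).dot (hc.isTest_hydroOperator hus (hβ.singleTest i)).contDiff)
  simp only [sum_singleTest_mul, hydroOperator_singleTest] at hzero hint
  rw [← hzero, ← sub_zero (∫ x, _ + _), ← htotal.integral_deriv, ← integral_sub]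
  · refine integral_congr_ae (ae_of_all _ fun y => ?_)
    simp only [((hus.hasDerivAt_comp hc.isOpen (hc.metric i j) y).fun_mul
      ((hα.hasDerivAt y).fun_mul (hβ.hasDerivAt y))).deriv, sub_mul, add_mul,
      Finset.sum_sub_distrib, Finset.sum_add_distrib]
    ring
  · exact hint.integrable
  · exact htotal.deriv.integrable

theorem isSkewOn_weaklyNonlocal_iff_skewRelations (hc : SmoothCoefficients U g Γ f) :
    IsSkewOn U (weaklyNonlocal g Γ f ε) ↔ SkewRelations U g Γ := by
  constructor
  · intro hskew
    have hrel : ∀ u ∈ U, ∀ i j k, g u i j = g u j i ∧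
        partialDeriv (fun v => g v i j) k u = Γ u i j k + Γ u j i k := fun u₀ hu₀ i j k => by
      obtain ⟨u, hu, rfl, hvelocity⟩ := exists_isFieldIn_hasDerivAt hc.isOpen hu₀ (Pi.single k 1)
      obtain ⟨β, hβ, hone⟩ := exists_isTest_eventuallyEq_one
      have hvalue : β 0 = 1 := hone.self_of_nhds
      have hslope : deriv β 0 = 0 := hone.deriv_eq.trans (deriv_const 0 1)
      have hslope_mul : deriv (fun x => x * β x) 0 = 1 :=
        ((hasDerivAt_id (0 : ℝ)).fun_mul (hβ.hasDerivAt 0)).deriv.trans (by simp [hvalue])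
      have hconst := hskew.metric_symbol_relation hc hu hβ i j 0
      have hlinear := hskew.metric_symbol_relation hc hu (hβ.mul_left contDiff_id) i j 0
      have hcoord : ∀ l, deriv (fun y => u y l) 0 = (Pi.single k 1 : Fin n → ℝ) l := fun l =>
        (hasDerivAt_pi.1 hvelocity l).deriv
      simp only [hcoord, hvalue, hslope, Pi.single_apply, mul_ite, mul_one, mul_zero, zero_add,
        Finset.sum_ite_eq', Finset.mem_univ, if_true] at hconst
      simp only [id, hslope_mul, zero_mul, mul_zero, mul_one, add_zero] at hlinear
      exact ⟨by linear_combination -hlinear, by linear_combination -hconst⟩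
    exact ⟨fun u hu i j => (hrel u hu i j i).1, fun u hu i j k => (hrel u hu i j k).2⟩
  · refine fun hs => (isSkewOn_weaklyNonlocal_iff hc).2 fun u φ ψ hu hφ hψ => ?_
    simp only [← (hs.dot_hydroOperator_add_swap hc hu.isSmoothIn hφ.contDiff hψ.contDiff _).deriv]
    exact (hc.isTest_sum_sum_metric_mul hu.isSmoothIn hφ hψ).integral_deriv

end Skewness

section JacobiDecomposition

variable {n : ℕ} {U : Set (Fin n → ℝ)} {g : (Fin n → ℝ) → Matrix (Fin n) (Fin n) ℝ}
  {Γ : (Fin n → ℝ) → Fin n → Fin n → Fin n → ℝ} {f : (Fin n → ℝ) → Fin n → ℝ} {ε : ℝ}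
  {u v w φ ψ χ : ℝ → Fin n → ℝ}

/-- The potential `∂ₓ⁻¹ (fʲ(u) ψⱼ)` produced by the nonlocal tail. -/
noncomputable def potential (f : (Fin n → ℝ) → Fin n → ℝ) (u ψ : ℝ → Fin n → ℝ) : ℝ → ℝ :=
  dxInv (contract f u ψ)

/-- The integrand of `jacobiTerm`, after moving `dxInv` off the linearized covectors. -/
noncomputable def jacobiDensity (g : (Fin n → ℝ) → Matrix (Fin n) (Fin n) ℝ)
    (Γ : (Fin n → ℝ) → Fin n → Fin n → Fin n → ℝ) (f : (Fin n → ℝ) → Fin n → ℝ) (ε : ℝ)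
    (u φ ψ χ : ℝ → Fin n → ℝ) (x : ℝ) : ℝ :=
  (∑ i, φ x i * hydroLinear g Γ u (weaklyNonlocal g Γ f ε u χ) ψ x i) +
    ε * (contractLinear f u (weaklyNonlocal g Γ f ε u χ) φ x * potential f u ψ x -
      contractLinear f u (weaklyNonlocal g Γ f ε u χ) ψ x * potential f u φ x)

/-- The density of `jacobiTerm` for the local operator `hydroOperator g Γ`. -/
noncomputable def localTerm (g : (Fin n → ℝ) → Matrix (Fin n) (Fin n) ℝ)
    (Γ : (Fin n → ℝ) → Fin n → Fin n → Fin n → ℝ) (u φ ψ χ : ℝ → Fin n → ℝ) (x : ℝ) : ℝ :=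
  ∑ i, φ x i * hydroLinear g Γ u (hydroOperator g Γ u χ) ψ x i

/-- The part of the density of `jacobiTerm` that is linear in the tail, arranged (up to a cyclic
permutation of the covectors) so that every term contains the potential of `χ`. -/
noncomputable def mixedTerm (g : (Fin n → ℝ) → Matrix (Fin n) (Fin n) ℝ)
    (Γ : (Fin n → ℝ) → Fin n → Fin n → Fin n → ℝ) (f : (Fin n → ℝ) → Fin n → ℝ)
    (u φ ψ χ : ℝ → Fin n → ℝ) (x : ℝ) : ℝ :=
  (∑ i, φ x i * hydroLinear g Γ u (tailOperator f u χ) ψ x i) +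
    (contractLinear f u (hydroOperator g Γ u φ) ψ x -
      contractLinear f u (hydroOperator g Γ u ψ) φ x) * potential f u χ x

theorem hydroLinear_add_smul (hv : ContDiff ℝ ∞ v) (hw : ContDiff ℝ ∞ w) (c x : ℝ) (i : Fin n) :
    hydroLinear g Γ u (v + c • w) ψ x i =
      hydroLinear g Γ u v ψ x i + c * hydroLinear g Γ u w ψ x i := by
  have hderiv : ∀ k, deriv (fun y => (v + c • w) y k) x =
      deriv (fun y => v y k) x + c * deriv (fun y => w y k) x := fun k =>
    ((hasDerivAt_apply_of_contDiff hv k x).fun_add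
      ((hasDerivAt_apply_of_contDiff hw k x).const_mul c)).deriv
  simp only [hydroLinear, hderiv]
  simp only [Pi.add_apply, Pi.smul_apply, map_add, map_smul, smul_eq_mul, Finset.mul_sum,
    ← Finset.sum_add_distrib]
  refine Finset.sum_congr rfl fun j _ => ?_
  simp only [add_mul, mul_add, Finset.sum_add_distrib, Finset.mul_sum, mul_assoc, mul_left_comm c]
  ring

theorem contractLinear_add_smul (f : (Fin n → ℝ) → Fin n → ℝ) (u v w ψ : ℝ → Fin n → ℝ)
    (c x : ℝ) : contractLinear f u (v + c • w) ψ x =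
      contractLinear f u v ψ x + c * contractLinear f u w ψ x := by
  simp only [contractLinear, Pi.add_apply, Pi.smul_apply, map_add, map_smul, smul_eq_mul, add_mul,
    Finset.sum_add_distrib, Finset.mul_sum, mul_assoc]

theorem contractLinear_tailOperator (f : (Fin n → ℝ) → Fin n → ℝ) (u ψ χ : ℝ → Fin n → ℝ) (x : ℝ) :
    contractLinear f u (tailOperator f u χ) ψ x =
      potential f u χ x * contractLinear f u (fun y => f (u y)) ψ x := by
  have htail : tailOperator f u χ x = potential f u χ x • f (u x) := funext fun i => mul_comm _ _
  simp only [contractLinear, htail, map_smul, smul_eq_mul, Finset.mul_sum, mul_assoc]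

namespace SmoothCoefficients

theorem isTest_jacobiDensity (hc : SmoothCoefficients U g Γ f) (hu : IsSmoothIn U u)
    (hφ : IsTest φ) (hψ : IsTest ψ) (hχ : IsTest χ) : IsTest (jacobiDensity g Γ f ε u φ ψ χ) :=
  have hv := hc.contDiff_weaklyNonlocal (ε := ε) hu hχ
  (hφ.dot (hc.isTest_hydroLinear hu hv hψ).contDiff).add <| IsTest.mul_left contDiff_const <|
    ((hc.isTest_contractLinear hu hv hφ).mul_right (hc.isTest_contract hu hψ).contDiff_dxInv).sub
      ((hc.isTest_contractLinear hu hv hψ).mul_right (hc.isTest_contract hu hφ).contDiff_dxInv)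

theorem jacobiTerm_eq_integral (hc : SmoothCoefficients U g Γ f) (hu : IsSmoothIn U u)
    (hφ : IsTest φ) (hψ : IsTest ψ) (hχ : IsTest χ) :
    jacobiTerm g Γ f ε u φ ψ χ = ∫ x, jacobiDensity g Γ f ε u φ ψ χ x := by
  have hv := hc.contDiff_weaklyNonlocal (ε := ε) hu hχ
  have hφv := hc.isTest_contractLinear hu hv hφ
  have hψv := hc.isTest_contractLinear hu hv hψ
  have hφψ := hφv.mul_right (hc.isTest_contract hu hψ).contDiff_dxInv
  have hψφ := hψv.mul_right (hc.isTest_contract hu hφ).contDiff_dxInv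
  simp only [jacobiTerm, linearPairing, jacobiDensity, potential]
  rw [integral_mul_dxInv_swap (hc.isTest_contract hu hφ).integrable hψv.integrable, integral_add
    (hφ.dot (hc.isTest_hydroLinear hu hv hψ).contDiff).integrable
    ((hφψ.sub hψφ).integrable.const_mul ε), integral_const_mul,
    integral_sub hφψ.integrable hψφ.integrable, sub_eq_add_neg]

/-- The terms quadratic in the tail cancel in the cyclic sum. -/
theorem cyclicSum_jacobiTerm_eq_integral (hc : SmoothCoefficients U g Γ f) (hu : IsSmoothIn U u)
    (hφ : IsTest φ) (hψ : IsTest ψ) (hχ : IsTest χ) :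
    cyclicSum (jacobiTerm g Γ f ε u) φ ψ χ =
      ∫ x, (cyclicSum (localTerm g Γ u) φ ψ χ x + ε * cyclicSum (mixedTerm g Γ f u) φ ψ χ x) := by
  have hφψχ := hc.isTest_jacobiDensity (ε := ε) hu hφ hψ hχ
  have hψχφ := hc.isTest_jacobiDensity (ε := ε) hu hψ hχ hφ
  have hχφψ := hc.isTest_jacobiDensity (ε := ε) hu hχ hφ hψ
  rw [cyclicSum, hc.jacobiTerm_eq_integral hu hφ hψ hχ, hc.jacobiTerm_eq_integral hu hψ hχ hφ,
    hc.jacobiTerm_eq_integral hu hχ hφ hψ, ← integral_add hφψχ.integrable hψχφ.integrable,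
    ← integral_add (hφψχ.add hψχφ).integrable hχφψ.integrable]
  refine integral_congr_ae (ae_of_all _ fun x => ?_)
  have hlinear : ∀ {φ ψ χ}, IsTest χ →
      ∑ i, φ x i * hydroLinear g Γ u (weaklyNonlocal g Γ f ε u χ) ψ x i =
        localTerm g Γ u φ ψ χ x +
          ε * ∑ i, φ x i * hydroLinear g Γ u (tailOperator f u χ) ψ x i := fun hχ => by
    simp only [weaklyNonlocal, Pi.add_apply, Pi.smul_apply, hydroLinear_add_smul
      (hc.isTest_hydroOperator hu hχ).contDiff (hc.contDiff_tailOperator hu hχ), mul_add,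
      Finset.sum_add_distrib, Finset.mul_sum, localTerm, mul_left_comm]
  simp only [jacobiDensity, hlinear hφ, hlinear hψ, hlinear hχ]
  simp only [weaklyNonlocal, Pi.add_apply, Pi.smul_apply, contractLinear_add_smul,
    contractLinear_tailOperator, cyclicSum, mixedTerm]
  ring

end SmoothCoefficients

end JacobiDecomposition

section LieDerivative

variable {n : ℕ} {U : Set (Fin n → ℝ)} {g : (Fin n → ℝ) → Matrix (Fin n) (Fin n) ℝ}
  {Γ : (Fin n → ℝ) → Fin n → Fin n → Fin n → ℝ} {f : (Fin n → ℝ) → Fin n → ℝ} {ε : ℝ}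
  {u v φ ψ χ : ℝ → Fin n → ℝ}

/-- The Lie derivative of the contravariant metric `gⁱʲ` along `f`. -/
noncomputable def lieMetric (g : (Fin n → ℝ) → Matrix (Fin n) (Fin n) ℝ)
    (f : (Fin n → ℝ) → Fin n → ℝ) (u : Fin n → ℝ) : Matrix (Fin n) (Fin n) ℝ := fun i j =>
  ∑ k, (f u k * partialDeriv (fun v => g v i j) k u
    - g u k j * partialDeriv (fun v => f v i) k u
    - g u i k * partialDeriv (fun v => f v j) k u)

theorem isInfinitesimalIsometry_iff_lieMetric_eq_zero :
    IsInfinitesimalIsometry U g f ↔ ∀ u ∈ U, lieMetric g f u = 0 :=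
  ⟨fun hf u hu => Matrix.ext (hf u hu), fun hlie u hu => congrFun₂ (hlie u hu)⟩

/-- The Lie derivative of the contravariant symbol `Γⁱʲₖ` along `f`, i.e. the coefficient of
`uᵏₓ` in the Lie derivative of the operator `gⁱʲ ∂ₓ + Γⁱʲₖ uᵏₓ`. -/
noncomputable def lieSymbol (g : (Fin n → ℝ) → Matrix (Fin n) (Fin n) ℝ)
    (Γ : (Fin n → ℝ) → Fin n → Fin n → Fin n → ℝ) (f : (Fin n → ℝ) → Fin n → ℝ)
    (u : Fin n → ℝ) (i j k : Fin n) : ℝ :=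
  ∑ m, (f u m * partialDeriv (fun v => Γ v i j k) m u
    + Γ u i j m * partialDeriv (fun v => f v m) k u
    - g u i m * partialDeriv (partialDeriv (fun v => f v j) m) k u
    - Γ u i m k * partialDeriv (fun v => f v j) m u
    - partialDeriv (fun v => f v i) m u * Γ u m j k)

/-- The covariant derivative of `f` with raised index, `∇ⁱ fʲ = gⁱᵏ ∂ₖ fʲ - Γⁱʲₖ fᵏ`. -/
noncomputable def raisedGradient (g : (Fin n → ℝ) → Matrix (Fin n) (Fin n) ℝ)
    (Γ : (Fin n → ℝ) → Fin n → Fin n → Fin n → ℝ) (f : (Fin n → ℝ) → Fin n → ℝ)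
    (u : Fin n → ℝ) : Matrix (Fin n) (Fin n) ℝ := fun i j =>
  ∑ k, (g u i k * partialDeriv (fun v => f v j) k u - Γ u i j k * f u k)

/-- The covector `∂ᵢ fʲ(u) ψⱼ`, the transpose of the Jacobian of `f` applied to `ψ`. -/
noncomputable def jacobianTranspose (f : (Fin n → ℝ) → Fin n → ℝ) (u ψ : ℝ → Fin n → ℝ) (x : ℝ)
    (i : Fin n) : ℝ :=
  ∑ j, partialDeriv (fun v => f v j) i (u x) * ψ x j

theorem contractLinear_eq_sum_jacobianTranspose (f : (Fin n → ℝ) → Fin n → ℝ)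
    (u v ψ : ℝ → Fin n → ℝ) (x : ℝ) :
    contractLinear f u v ψ x = ∑ i, jacobianTranspose f u ψ x i * v x i := by
  simp only [contractLinear, jacobianTranspose, fderiv_apply_eq_sum_partialDeriv, Finset.sum_mul]
  rw [Finset.sum_comm]
  simp only [mul_right_comm]

theorem fderiv_vector_hydroOperator (f : (Fin n → ℝ) → Fin n → ℝ) (u ψ : ℝ → Fin n → ℝ) (x : ℝ)
    (i : Fin n) : fderiv ℝ (fun v => f v i) (u x) (hydroOperator g Γ u ψ x) =
      hydroOperator (fun w i j => ∑ m, partialDeriv (fun v => f v i) m w * g w m j)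
        (fun w i j k => ∑ m, partialDeriv (fun v => f v i) m w * Γ w m j k) u ψ x i := by
  simp only [fderiv_apply_eq_sum_partialDeriv, hydroOperator, Finset.mul_sum]
  rw [Finset.sum_comm]
  refine Finset.sum_congr rfl fun j _ => ?_
  simp only [mul_add, Finset.sum_add_distrib, Finset.mul_sum, Finset.sum_mul, mul_assoc]
  rw [Finset.sum_comm (f := fun m k => _ * (Γ (u x) m j k * _))]

theorem SkewRelations.raisedGradient_add_swap (hs : SkewRelations U g Γ) {u : Fin n → ℝ}
    (hu : u ∈ U) (i j : Fin n) :
    raisedGradient g Γ f u i j + raisedGradient g Γ f u j i = -lieMetric g f u i j := by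
  simp only [raisedGradient, lieMetric, ← Finset.sum_add_distrib, ← Finset.sum_neg_distrib,
    hs.compat u hu]
  refine Finset.sum_congr rfl fun k _ => ?_
  rw [hs.symm u hu k j]
  ring

namespace SmoothCoefficients

theorem isTest_jacobianTranspose (hc : SmoothCoefficients U g Γ f) (hu : IsSmoothIn U u)
    (hψ : IsTest ψ) : IsTest (jacobianTranspose f u ψ) :=
  .pi fun i => .sum fun j _ =>
    (hψ.apply j).mul_left (hu.comp (contDiffOn_partialDeriv hc.isOpen (hc.vector j) i))

theorem hydroLinear_vector (hc : SmoothCoefficients U g Γ f) (hu : IsSmoothIn U u)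
    (ψ : ℝ → Fin n → ℝ) (x : ℝ) (i : Fin n) :
    hydroLinear g Γ u (fun y => f (u y)) ψ x i =
      hydroOperator (fun w i j => ∑ m, f w m * partialDeriv (fun v => g v i j) m w)
        (fun w i j k => ∑ m, (f w m * partialDeriv (fun v => Γ v i j k) m w +
          Γ w i j m * partialDeriv (fun v => f v m) k w)) u ψ x i := by
  refine Finset.sum_congr rfl fun j _ => ?_
  have hswap : ∑ k, Γ (u x) i j k * ∑ m, partialDeriv (fun v => f v k) m (u x) *
      deriv (fun y => u y m) x = ∑ k, (∑ m, Γ (u x) i j m *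
        partialDeriv (fun v => f v m) k (u x)) * deriv (fun y => u y k) x := by
    simp only [Finset.mul_sum, Finset.sum_mul, mul_assoc]
    exact Finset.sum_comm
  simp only [fderiv_apply_eq_sum_partialDeriv, (hu.hasDerivAt_comp hc.isOpen (hc.vector _) x).deriv,
    ← Finset.sum_mul, Finset.sum_add_distrib, add_mul, hswap, mul_comm (f (u x) _)]

theorem hydroOperator_jacobianTranspose (hc : SmoothCoefficients U g Γ f) (hu : IsSmoothIn U u)
    (hψ : ContDiff ℝ ∞ ψ) (x : ℝ) (i : Fin n) :
    hydroOperator g Γ u (jacobianTranspose f u ψ) x i =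
      hydroOperator (fun w i j => ∑ m, g w i m * partialDeriv (fun v => f v j) m w)
        (fun w i j k => ∑ m, (g w i m * partialDeriv (partialDeriv (fun v => f v j) m) k w +
          Γ w i m k * partialDeriv (fun v => f v j) m w)) u ψ x i := by
  have hderiv : ∀ m, deriv (fun y => jacobianTranspose f u ψ y m) x =
      ∑ j, ((∑ k, partialDeriv (partialDeriv (fun v => f v j) m) k (u x) *
        deriv (fun y => u y k) x) * ψ x j +
          partialDeriv (fun v => f v j) m (u x) * deriv (fun y => ψ y j) x) := fun m =>
    (HasDerivAt.fun_sum fun j _ => (hu.hasDerivAt_comp hc.isOpen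
      (contDiffOn_partialDeriv hc.isOpen (hc.vector j) m) x).fun_mul
        (hasDerivAt_apply_of_contDiff hψ j x)).deriv
  simp only [hydroOperator, hderiv]
  simp only [jacobianTranspose, ← Finset.sum_mul]
  simp only [Finset.mul_sum, ← Finset.sum_add_distrib]
  rw [Finset.sum_comm]
  refine Finset.sum_congr rfl fun j _ => ?_
  simp only [Finset.sum_mul, Finset.sum_add_distrib, mul_add, add_mul, Finset.mul_sum]
  rw [Finset.sum_comm (f := fun m k => g (u x) i m * (_ * _ * _)),
    Finset.sum_comm (f := fun m k => Γ (u x) i m k * _ * _)]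
  simp only [mul_assoc, mul_left_comm (deriv (fun y => u y _) x)]
  ring

theorem hydroLinear_sub_hydroOperator_sub_fderiv (hc : SmoothCoefficients U g Γ f)
    (hu : IsSmoothIn U u) (hψ : ContDiff ℝ ∞ ψ) (x : ℝ) (i : Fin n) :
    hydroLinear g Γ u (fun y => f (u y)) ψ x i - hydroOperator g Γ u (jacobianTranspose f u ψ) x i -
        fderiv ℝ (fun v => f v i) (u x) (hydroOperator g Γ u ψ x) =
      hydroOperator (lieMetric g f) (lieSymbol g Γ f) u ψ x i := by
  rw [hc.hydroLinear_vector hu, hc.hydroOperator_jacobianTranspose hu hψ,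
    fderiv_vector_hydroOperator]
  simp only [hydroOperator, ← Finset.sum_sub_distrib]
  refine Finset.sum_congr rfl fun j _ => ?_
  simp only [lieMetric, lieSymbol, Finset.sum_sub_distrib, Finset.sum_add_distrib, sub_mul, add_mul,
    mul_comm (partialDeriv _ _ _)]
  ring

end SmoothCoefficients

end LieDerivative

section MixedTerm

variable {n : ℕ} {U : Set (Fin n → ℝ)} {g : (Fin n → ℝ) → Matrix (Fin n) (Fin n) ℝ}
  {Γ : (Fin n → ℝ) → Fin n → Fin n → Fin n → ℝ} {f : (Fin n → ℝ) → Fin n → ℝ} {ε : ℝ}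
  {u φ ψ χ : ℝ → Fin n → ℝ}

/-- The density to which `mixedTerm` reduces modulo total derivatives: the Lie derivative of
`gⁱʲ ∂ₓ + Γⁱʲₖ uᵏₓ` along `f`, and the tensor `∇ⁱ fʲ`, both paired with `φ` and `ψ`. -/
noncomputable def lieTerm (g : (Fin n → ℝ) → Matrix (Fin n) (Fin n) ℝ)
    (Γ : (Fin n → ℝ) → Fin n → Fin n → Fin n → ℝ) (f : (Fin n → ℝ) → Fin n → ℝ)
    (u φ ψ χ : ℝ → Fin n → ℝ) (x : ℝ) : ℝ :=
  potential f u χ x * (∑ i, φ x i * hydroOperator (lieMetric g f) (lieSymbol g Γ f) u ψ x i) -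
    contract f u χ x * ∑ i, φ x i * ∑ j, raisedGradient g Γ f (u x) i j * ψ x j

/-- The flux whose derivative is `mixedTerm - lieTerm`. -/
noncomputable def mixedFlux (g : (Fin n → ℝ) → Matrix (Fin n) (Fin n) ℝ)
    (f : (Fin n → ℝ) → Fin n → ℝ) (u φ ψ χ : ℝ → Fin n → ℝ) (x : ℝ) : ℝ :=
  potential f u χ x * ∑ i, ∑ j, g (u x) i j * (φ x i * jacobianTranspose f u ψ x j)

theorem sum_raisedGradient_mul (u ψ : ℝ → Fin n → ℝ) (x : ℝ) (i : Fin n) :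
    ∑ j, raisedGradient g Γ f (u x) i j * ψ x j =
      (∑ j, g (u x) i j * jacobianTranspose f u ψ x j) -
        ∑ j, (∑ k, Γ (u x) i j k * f (u x) k) * ψ x j := by
  simp only [raisedGradient, jacobianTranspose, Finset.sum_sub_distrib, sub_mul, Finset.sum_mul,
    Finset.mul_sum, mul_assoc]
  rw [Finset.sum_comm (f := fun j k => g (u x) i k * _)]

theorem contractLinear_eq_sum_fderiv (f : (Fin n → ℝ) → Fin n → ℝ) (u v ψ : ℝ → Fin n → ℝ) (x : ℝ) :
    contractLinear f u v ψ x = ∑ i, ψ x i * fderiv ℝ (fun w => f w i) (u x) (v x) :=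
  Finset.sum_congr rfl fun _ _ => mul_comm _ _

namespace SmoothCoefficients

theorem hydroLinear_tailOperator (hc : SmoothCoefficients U g Γ f) (hu : IsSmoothIn U u)
    (hχ : IsTest χ) (x : ℝ) (i : Fin n) :
    hydroLinear g Γ u (tailOperator f u χ) ψ x i =
      potential f u χ x * hydroLinear g Γ u (fun y => f (u y)) ψ x i +
        contract f u χ x * ∑ j, (∑ k, Γ (u x) i j k * f (u x) k) * ψ x j := by
  have htail : tailOperator f u χ x = potential f u χ x • f (u x) := funext fun i => mul_comm _ _
  have hderiv : ∀ k, deriv (fun y => tailOperator f u χ y k) x =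
      deriv (fun y => f (u y) k) x * potential f u χ x + f (u x) k * contract f u χ x := fun k =>
    ((hu.hasDerivAt_comp hc.isOpen (hc.vector k) x).differentiableAt.hasDerivAt.fun_mul
      ((hc.isTest_contract hu hχ).hasDerivAt_dxInv x)).deriv
  simp only [hydroLinear, htail, hderiv, map_smul, smul_eq_mul]
  rw [Finset.mul_sum, Finset.mul_sum, ← Finset.sum_add_distrib]
  refine Finset.sum_congr rfl fun j _ => ?_
  rw [mul_add, add_assoc, Finset.sum_mul, Finset.mul_sum, Finset.mul_sum,
    ← Finset.sum_add_distrib]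
  exact congrArg₂ _ (by ring) (Finset.sum_congr rfl fun k _ => by ring)

theorem isTest_mixedFlux (hc : SmoothCoefficients U g Γ f) (hu : IsSmoothIn U u) (hφ : IsTest φ)
    (hψ : IsTest ψ) (hχ : IsTest χ) : IsTest (mixedFlux g f u φ ψ χ) :=
  (hc.isTest_sum_sum_metric_mul hu hφ (hc.isTest_jacobianTranspose hu hψ)).mul_left
    (hc.isTest_contract hu hχ).contDiff_dxInv

theorem isTest_mixedTerm (hc : SmoothCoefficients U g Γ f) (hu : IsSmoothIn U u) (hφ : IsTest φ)
    (hψ : IsTest ψ) (hχ : IsTest χ) : IsTest (mixedTerm g Γ f u φ ψ χ) :=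
  (hφ.dot (hc.isTest_hydroLinear hu (hc.contDiff_tailOperator hu hχ) hψ).contDiff).add <|
    ((hc.isTest_contractLinear hu (hc.isTest_hydroOperator hu hφ).contDiff hψ).sub
      (hc.isTest_contractLinear hu (hc.isTest_hydroOperator hu hψ).contDiff hφ)).mul_right
        (hc.isTest_contract hu hχ).contDiff_dxInv

theorem isTest_localTerm (hc : SmoothCoefficients U g Γ f) (hu : IsSmoothIn U u) (hφ : IsTest φ)
    (hψ : IsTest ψ) (hχ : IsTest χ) : IsTest (localTerm g Γ u φ ψ χ) :=
  hφ.dot (hc.isTest_hydroLinear hu (hc.isTest_hydroOperator hu hχ).contDiff hψ).contDiff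

/-- Skew-symmetry moves `hydroOperator g Γ` from `φ` to the transported covector
`jacobianTranspose f u ψ`; what remains is the commutator of the flow of `f` with the operator. -/
theorem hasDerivAt_mixedFlux (hc : SmoothCoefficients U g Γ f) (hs : SkewRelations U g Γ)
    (hu : IsSmoothIn U u) (hφ : IsTest φ) (hψ : IsTest ψ) (hχ : IsTest χ) (x : ℝ) :
    HasDerivAt (mixedFlux g f u φ ψ χ)
      (mixedTerm g Γ f u φ ψ χ x - lieTerm g Γ f u φ ψ χ x) x := by
  refine (((hc.isTest_contract hu hχ).hasDerivAt_dxInv x).fun_mul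
    (hs.dot_hydroOperator_add_swap hc hu hφ.contDiff
      (hc.isTest_jacobianTranspose hu hψ).contDiff x)).congr_deriv ?_
  simp only [mixedTerm, lieTerm, hc.hydroLinear_tailOperator hu hχ, sum_raisedGradient_mul,
    ← hc.hydroLinear_sub_hydroOperator_sub_fderiv hu hψ.contDiff]
  rw [contractLinear_eq_sum_jacobianTranspose, contractLinear_eq_sum_fderiv f u _ φ]
  simp only [potential, mul_add, mul_sub, sub_mul, Finset.sum_add_distrib, Finset.sum_sub_distrib,
    Finset.mul_sum, Finset.sum_mul, mul_left_comm (φ x _)]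
  ring_nf

theorem cyclicSum_jacobiTerm_eq_integral_lieTerm (hc : SmoothCoefficients U g Γ f)
    (hs : SkewRelations U g Γ) (hu : IsSmoothIn U u)
    (hφ : IsTest φ) (hψ : IsTest ψ) (hχ : IsTest χ) :
    cyclicSum (jacobiTerm g Γ f ε u) φ ψ χ =
      ∫ x, (cyclicSum (localTerm g Γ u) φ ψ χ x + ε * cyclicSum (lieTerm g Γ f u) φ ψ χ x) := by
  have hdensity := ((((hc.isTest_localTerm hu hφ hψ hχ).add (hc.isTest_localTerm hu hψ hχ hφ)).add
    (hc.isTest_localTerm hu hχ hφ hψ)).add <| IsTest.mul_left (contDiff_const (c := ε))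
      (((hc.isTest_mixedTerm hu hφ hψ hχ).add (hc.isTest_mixedTerm hu hψ hχ hφ)).add
        (hc.isTest_mixedTerm hu hχ hφ hψ))).integrable
  have hflux := IsTest.mul_left (contDiff_const (c := ε)) <|
    ((hc.isTest_mixedFlux hu hφ hψ hχ).add (hc.isTest_mixedFlux hu hψ hχ hφ)).add
      (hc.isTest_mixedFlux hu hχ hφ hψ)
  rw [hc.cyclicSum_jacobiTerm_eq_integral hu hφ hψ hχ, ← sub_zero (∫ _, _),
    ← hflux.integral_deriv]
  refine (integral_sub hdensity hflux.deriv.integrable).symm.trans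
    (integral_congr_ae (ae_of_all _ fun x => ?_))
  have hderiv := ((((hc.hasDerivAt_mixedFlux hs hu hφ hψ hχ x).fun_add
    (hc.hasDerivAt_mixedFlux hs hu hψ hχ hφ x)).fun_add
      (hc.hasDerivAt_mixedFlux hs hu hχ hφ hψ x)).const_mul ε).deriv
  simp only [hderiv, cyclicSum, Pi.add_apply]
  ring

end SmoothCoefficients

/-- A trilinear form alternating in its arguments vanishes in the plane. -/
theorem cyclicSum_lieTerm_eq_zero {U : Set (Fin 2 → ℝ)}
    {g : (Fin 2 → ℝ) → Matrix (Fin 2) (Fin 2) ℝ} {Γ : (Fin 2 → ℝ) → Fin 2 → Fin 2 → Fin 2 → ℝ}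
    {f : (Fin 2 → ℝ) → Fin 2 → ℝ} {u : ℝ → Fin 2 → ℝ} (hs : SkewRelations U g Γ)
    (hf : IsInfinitesimalIsometry U g f) (hu : ∀ x, u x ∈ U)
    (hlie : ∀ ψ, hydroOperator (lieMetric g f) (lieSymbol g Γ f) u ψ = 0)
    (φ ψ χ : ℝ → Fin 2 → ℝ) (x : ℝ) : cyclicSum (lieTerm g Γ f u) φ ψ χ x = 0 := by
  have hskew : ∀ i j, raisedGradient g Γ f (u x) i j = -raisedGradient g Γ f (u x) j i :=
    fun i j => eq_neg_of_add_eq_zero_left <| (hs.raisedGradient_add_swap (hu x) i j).trans <|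
      neg_eq_zero.2 (hf _ (hu x) i j)
  have hdiag : ∀ i, raisedGradient g Γ f (u x) i i = 0 := fun i => self_eq_neg.1 (hskew i i)
  simp only [cyclicSum, Pi.add_apply, lieTerm, hlie, Pi.zero_apply, contract, Fin.sum_univ_two,
    hdiag, hskew 1 0]
  ring

end MixedTerm

section ConstantFields

variable {n : ℕ} {U : Set (Fin n → ℝ)} {g : (Fin n → ℝ) → Matrix (Fin n) (Fin n) ℝ}
  {Γ : (Fin n → ℝ) → Fin n → Fin n → Fin n → ℝ} {f : (Fin n → ℝ) → Fin n → ℝ} {ε : ℝ}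
  {u₀ : Fin n → ℝ} {α β γ : ℝ → ℝ}

/-- The symbol with its lower index raised, `Γʲⁱₖ gᵏˡ`. -/
noncomputable def raisedSymbol (g : (Fin n → ℝ) → Matrix (Fin n) (Fin n) ℝ)
    (Γ : (Fin n → ℝ) → Fin n → Fin n → Fin n → ℝ) (u : Fin n → ℝ) (j i l : Fin n) : ℝ :=
  ∑ k, Γ u j i k * g u k l

/-- The connection with contravariant symbol `Γʲⁱₖ = -gʲᵐ Γⁱₘₖ` has no torsion: its raised symbol
is symmetric in the two outer indices. -/
def IsTorsionFree (U : Set (Fin n → ℝ)) (g : (Fin n → ℝ) → Matrix (Fin n) (Fin n) ℝ)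
    (Γ : (Fin n → ℝ) → Fin n → Fin n → Fin n → ℝ) : Prop :=
  ∀ u ∈ U, ∀ j i l, raisedSymbol g Γ u j i l = raisedSymbol g Γ u l i j

theorem isFieldIn_const (hu₀ : u₀ ∈ U) : IsFieldIn U fun _ => u₀ :=
  ⟨contDiff_const, {u₀}, isCompact_singleton, singleton_subset_iff.2 hu₀, fun _ => rfl⟩

theorem IsTest.integral_mul_deriv_deriv (hβ : IsTest β) :
    ∫ x, β x * deriv (deriv β) x = -∫ x, deriv β x ^ 2 := by
  have htotal := (hβ.mul_right hβ.deriv.contDiff).integral_deriv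
  simp only [((hβ.hasDerivAt _).fun_mul (hβ.deriv.hasDerivAt _)).deriv] at htotal
  rw [integral_add (hβ.deriv.mul_right hβ.deriv.contDiff).integrable
    (hβ.mul_right hβ.deriv.deriv.contDiff).integrable] at htotal
  simp only [sq]
  linear_combination htotal

theorem IsTest.integral_deriv_sq_pos (hβ : IsTest β) (hne : ∃ x, β x ≠ 0) :
    0 < ∫ x, deriv β x ^ 2 := by
  obtain ⟨x, hx⟩ : ∃ x, deriv β x ≠ 0 := by
    by_contra! hderiv
    obtain ⟨x, hx⟩ := hne
    obtain ⟨y, hy⟩ := (ne_univ_iff_exists_notMem _).1 hβ.hasCompactSupport.isCompact.ne_univ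
    exact hx ((is_const_of_deriv_eq_zero (hβ.contDiff.differentiable (by simp)) hderiv x y).trans
      (image_eq_zero_of_notMem_tsupport hy))
  simp only [sq]
  have hsq := hβ.deriv.mul_right hβ.deriv.contDiff
  exact hsq.contDiff.continuous.integral_pos_of_hasCompactSupport_nonneg_nonzero
    hsq.hasCompactSupport (fun x => mul_self_nonneg _) (mul_self_ne_zero.2 hx)

theorem exists_isTest_separated : ∃ β γ : ℝ → ℝ, IsTest β ∧ IsTest γ ∧
    (∀ x, (β =ᶠ[𝓝 x] fun _ => 0) ∨ ∀ᶠ z in 𝓝 x, ∀ y ≤ z, γ y = 0) ∧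
    ∫ x, γ x ≠ 0 ∧ ∫ x, deriv β x ^ 2 ≠ 0 := by
  let b : ContDiffBump (0 : ℝ) := ⟨1, 2, by simp, by simp⟩
  let c : ContDiffBump (5 : ℝ) := ⟨1, 2, by simp, by simp⟩
  have hb : IsTest b := ⟨b.contDiff, b.hasCompactSupport⟩
  refine ⟨b, c, hb, ⟨c.contDiff, c.hasCompactSupport⟩, fun x => ?_, c.integral_pos.ne',
    (hb.integral_deriv_sq_pos ⟨0, (b.pos_of_mem_ball (by simp [b])).ne'⟩).ne'⟩
  rcases lt_or_ge x 3 with hx | hx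
  · refine .inr ((eventually_lt_nhds hx).mono fun z hz y hy => c.zero_of_le_dist ?_)
    rw [Real.dist_eq, le_abs]
    exact .inr (by change (2 : ℝ) ≤ _; linarith)
  · refine .inl ((eventually_gt_nhds (show (2 : ℝ) < x by linarith)).mono fun z hz =>
      b.zero_of_le_dist ?_)
    rw [Real.dist_eq, le_abs]
    exact .inl (by change (2 : ℝ) ≤ _; linarith)

theorem exists_isTest_eventuallyEq_one_or_zero : ∃ α β : ℝ → ℝ, IsTest α ∧ IsTest β ∧
    (∀ x, (α =ᶠ[𝓝 x] fun _ => 1) ∨ β =ᶠ[𝓝 x] fun _ => 0) ∧ ∫ x, deriv β x ^ 2 ≠ 0 := by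
  let a : ContDiffBump (0 : ℝ) := ⟨3, 4, by simp, by norm_num⟩
  let b : ContDiffBump (0 : ℝ) := ⟨1, 2, by simp, by simp⟩
  have hb : IsTest b := ⟨b.contDiff, b.hasCompactSupport⟩
  refine ⟨a, b, ⟨a.contDiff, a.hasCompactSupport⟩, hb, fun x => ?_,
    (hb.integral_deriv_sq_pos ⟨0, (b.pos_of_mem_ball (by simp [b])).ne'⟩).ne'⟩
  rcases lt_or_ge (dist x 0) 3 with hx | hx
  · exact .inl (a.eventuallyEq_one_of_mem_ball hx)
  · refine .inr ((continuous_id.dist continuous_const).continuousAt.eventually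
      (eventually_gt_nhds (show (2 : ℝ) < dist x 0 by linarith)) |>.mono fun z hz =>
        b.zero_of_le_dist hz.le)

theorem localTerm_const_singleTest (hγ : IsTest γ) (α β : ℝ → ℝ) (i j l : Fin n) (x : ℝ) :
    localTerm g Γ (fun _ => u₀) (singleTest α i) (singleTest β j) (singleTest γ l) x =
      α x * ((∑ m, partialDeriv (fun v => g v i j) m u₀ * g u₀ m l) * (deriv γ x * deriv β x) +
        raisedSymbol g Γ u₀ i j l * (deriv (deriv γ) x * β x)) := by
  have hv : hydroOperator g Γ (fun _ => u₀) (singleTest γ l) = fun y k => g u₀ k l * deriv γ y :=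
    funext₂ fun y k => by simp [hydroOperator_singleTest]
  have hderiv : ∀ k, deriv (fun y => g u₀ k l * deriv γ y) x = g u₀ k l * deriv (deriv γ) x :=
    fun k => ((hγ.deriv.hasDerivAt x).const_mul _).deriv
  rw [localTerm, sum_singleTest_mul, hv]
  simp only [hydroLinear, deriv_const, mul_zero, zero_add, hderiv, deriv_singleTest,
    fderiv_apply_eq_sum_partialDeriv, Finset.sum_add_distrib, ← Finset.sum_mul]
  rw [sum_mul_singleTest fun j => ∑ k, partialDeriv (fun w => g w i j) k u₀ *
      (g u₀ k l * deriv γ x),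
    sum_mul_singleTest fun j => ∑ k, Γ u₀ i j k * (g u₀ k l * deriv (deriv γ) x)]
  simp only [raisedSymbol, ← mul_assoc, ← Finset.sum_mul]

theorem lieTerm_const_singleTest (α β γ : ℝ → ℝ) (i j l : Fin n) (x : ℝ) :
    lieTerm g Γ f (fun _ => u₀) (singleTest α i) (singleTest β j) (singleTest γ l) x =
      f u₀ l * dxInv γ x * (α x * (lieMetric g f u₀ i j * deriv β x)) -
        f u₀ l * γ x * (α x * (raisedGradient g Γ f u₀ i j * β x)) := by
  have hcontract : contract f (fun _ => u₀) (singleTest γ l) = fun x => f u₀ l * γ x :=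
    funext fun x => sum_mul_singleTest (f u₀) γ l x
  have hpotential : potential f (fun _ => u₀) (singleTest γ l) x = f u₀ l * dxInv γ x := by
    simp only [potential, hcontract, dxInv, integral_const_mul]
    ring
  rw [lieTerm, hpotential, hcontract, sum_singleTest_mul, sum_singleTest_mul,
    hydroOperator_singleTest, sum_mul_singleTest]
  simp

/-- Detection of `lieMetric` by the nonlocal tail: the test function `γ` to the right of the
support of `β` contributes only through the constant `-(1 / 2) * ∫ γ`. -/
theorem SmoothCoefficients.lieMetric_eq_zero_of_jacobiAt_const (hc : SmoothCoefficients U g Γ f)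
    (hs : SkewRelations U g Γ) (hε : ε ≠ 0) (hu₀ : u₀ ∈ U) (hf : f u₀ ≠ 0)
    (hJ : JacobiAt g Γ f ε fun _ => u₀) : lieMetric g f u₀ = 0 := by
  obtain ⟨k, hk : f u₀ k ≠ 0⟩ := Function.ne_iff.1 hf
  obtain ⟨β, γ, hβ, hγ, hsep, hγ₀, hβ₀⟩ := exists_isTest_separated
  ext i j
  have hzero := hJ _ _ _ (hβ.deriv.singleTest i) (hβ.singleTest j) (hγ.singleTest k)
  rw [hc.cyclicSum_jacobiTerm_eq_integral_lieTerm hs (isFieldIn_const hu₀).isSmoothIn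
    (hβ.deriv.singleTest i) (hβ.singleTest j) (hγ.singleTest k)] at hzero
  have hintegrand : ∀ x, cyclicSum (localTerm g Γ fun _ => u₀) (singleTest (deriv β) i)
      (singleTest β j) (singleTest γ k) x + ε * cyclicSum (lieTerm g Γ f fun _ => u₀)
        (singleTest (deriv β) i) (singleTest β j) (singleTest γ k) x =
      ε * f u₀ k * (-(1 / 2) * ∫ y, γ y) * lieMetric g f u₀ i j * deriv β x ^ 2 := fun x => by
    simp only [cyclicSum, Pi.add_apply, localTerm_const_singleTest hβ,
      localTerm_const_singleTest hγ, localTerm_const_singleTest hβ.deriv, lieTerm_const_singleTest]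
    rcases hsep x with hβx | hγx
    · simp [hβx.eq_of_nhds, hβx.deriv_eq, hβx.deriv.deriv_eq]
    · have hγx' : γ =ᶠ[𝓝 x] fun _ => 0 := hγx.mono fun z hz => hz z le_rfl
      rw [dxInv_eq_of_forall_le hγx.self_of_nhds]
      simp only [hγx'.eq_of_nhds, hγx'.deriv_eq, hγx'.deriv.deriv_eq, deriv_const']
      ring
  simp only [hintegrand, integral_const_mul] at hzero
  simpa [hε, hk, hγ₀, hβ₀] using hzero

theorem SmoothCoefficients.isInfinitesimalIsometry_of_ne_zero (hc : SmoothCoefficients U g Γ f)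
    (hlie : ∀ u ∈ U, f u ≠ 0 → lieMetric g f u = 0) : IsInfinitesimalIsometry U g f := by
  refine isInfinitesimalIsometry_iff_lieMetric_eq_zero.2 fun u hu => Matrix.ext fun i j => ?_
  by_cases hfreq : ∃ᶠ v in 𝓝 u, f v ≠ 0
  · have hcont : ContinuousOn (fun u => lieMetric g f u i j) U :=
      continuousOn_finsetSum _ fun k _ =>
        (((hc.vector k).continuousOn.mul
          (contDiffOn_partialDeriv hc.isOpen (hc.metric i j) k).continuousOn).sub
        ((hc.metric k j).continuousOn.mul
          (contDiffOn_partialDeriv hc.isOpen (hc.vector i) k).continuousOn)).sub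
        ((hc.metric i k).continuousOn.mul
          (contDiffOn_partialDeriv hc.isOpen (hc.vector j) k).continuousOn)
    refine isClosed_singleton.mem_of_frequently_of_tendsto
      ((hfreq.and_eventually (hc.isOpen.eventually_mem hu)).mono fun v hv => ?_)
      (hcont.continuousAt (hc.isOpen.mem_nhds hu))
    exact congrFun₂ (hlie v hv.2 hv.1) i j
  · have hf : ∀ k, (fun v => f v k) =ᶠ[𝓝 u] fun _ => 0 := fun k =>
      (not_frequently.1 hfreq).mono fun v hv => congrFun (not_not.1 hv) k
    simp [lieMetric, partialDeriv, (hf _).fderiv_eq, (hf _).eq_of_nhds]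

theorem SmoothCoefficients.raisedSymbol_comm_of_jacobiAt_const
    (hc : SmoothCoefficients U g Γ f) (hs : SkewRelations U g Γ) (hu₀ : u₀ ∈ U)
    (hlie : ∀ φ ψ χ x, cyclicSum (lieTerm g Γ f fun _ => u₀) φ ψ χ x = 0)
    (hJ : JacobiAt g Γ f ε fun _ => u₀) (j i l : Fin n) :
    raisedSymbol g Γ u₀ j i l = raisedSymbol g Γ u₀ l i j := by
  obtain ⟨α, β, hα, hβ, hαβ, hβ₀⟩ := exists_isTest_eventuallyEq_one_or_zero
  have hzero := hJ _ _ _ (hα.singleTest i) (hβ.singleTest j) (hβ.singleTest l)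
  rw [hc.cyclicSum_jacobiTerm_eq_integral_lieTerm hs (isFieldIn_const hu₀).isSmoothIn
    (hα.singleTest i) (hβ.singleTest j) (hβ.singleTest l)] at hzero
  have hcompat : ∑ m, partialDeriv (fun v => g v i j) m u₀ * g u₀ m l =
      raisedSymbol g Γ u₀ i j l + raisedSymbol g Γ u₀ j i l := by
    simp only [raisedSymbol, hs.compat _ hu₀, add_mul, Finset.sum_add_distrib]
  have hintegrand : ∀ x, cyclicSum (localTerm g Γ fun _ => u₀) (singleTest α i)
      (singleTest β j) (singleTest β l) x =
      (raisedSymbol g Γ u₀ i j l + raisedSymbol g Γ u₀ j i l) * deriv β x ^ 2 +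
        (raisedSymbol g Γ u₀ i j l + raisedSymbol g Γ u₀ l i j) *
          (β x * deriv (deriv β) x) := fun x => by
    simp only [cyclicSum, Pi.add_apply, localTerm_const_singleTest hβ,
      localTerm_const_singleTest hα, hcompat]
    rcases hαβ x with hαx | hβx
    · simp only [hαx.eq_of_nhds, hαx.deriv_eq, hαx.deriv.deriv_eq, deriv_const']
      ring
    · simp [hβx.eq_of_nhds, hβx.deriv_eq]
  simp only [hlie, hintegrand, mul_zero, add_zero] at hzero
  rw [integral_add (by simpa only [sq] using
      (hβ.deriv.mul_right hβ.deriv.contDiff).integrable.const_mul _)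
    ((hβ.mul_right hβ.deriv.deriv.contDiff).integrable.const_mul _), integral_const_mul,
    integral_const_mul, hβ.integral_mul_deriv_deriv] at hzero
  refine mul_right_cancel₀ hβ₀ ?_
  linear_combination hzero

end ConstantFields

section PartialDerivatives

variable {n : ℕ} {U : Set (Fin n → ℝ)} {a b : (Fin n → ℝ) → ℝ} {u : Fin n → ℝ}

theorem partialDeriv_add (ha : DifferentiableAt ℝ a u) (hb : DifferentiableAt ℝ b u) (k : Fin n) :
    partialDeriv (fun v => a v + b v) k u = partialDeriv a k u + partialDeriv b k u := by
  simp only [partialDeriv, fderiv_fun_add ha hb, add_apply]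

theorem partialDeriv_sub (ha : DifferentiableAt ℝ a u) (hb : DifferentiableAt ℝ b u) (k : Fin n) :
    partialDeriv (fun v => a v - b v) k u = partialDeriv a k u - partialDeriv b k u := by
  simp only [partialDeriv, fderiv_fun_sub ha hb, sub_apply]

theorem partialDeriv_mul (ha : DifferentiableAt ℝ a u) (hb : DifferentiableAt ℝ b u) (k : Fin n) :
    partialDeriv (fun v => a v * b v) k u =
      partialDeriv a k u * b u + a u * partialDeriv b k u := by
  simp [partialDeriv, fderiv_fun_mul ha hb, add_comm, mul_comm]

theorem partialDeriv_add_const_mul (ha : DifferentiableAt ℝ a u)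
    (hb : DifferentiableAt ℝ b u) (c : ℝ) (k : Fin n) :
    partialDeriv (fun v => a v + c * b v) k u = partialDeriv a k u + c * partialDeriv b k u := by
  rw [partialDeriv_add ha (hb.const_mul c)]
  simp only [partialDeriv, fderiv_const_mul hb, smul_apply, smul_eq_mul]

theorem partialDeriv_sum {ι : Type*} {s : Finset ι} {A : ι → (Fin n → ℝ) → ℝ}
    (hA : ∀ m ∈ s, DifferentiableAt ℝ (A m) u) (k : Fin n) :
    partialDeriv (fun v => ∑ m ∈ s, A m v) k u = ∑ m ∈ s, partialDeriv (A m) k u := by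
  simp only [partialDeriv, fderiv_fun_sum hA, sum_apply]

theorem partialDeriv_congr (hU : IsOpen U) (hab : ∀ v ∈ U, a v = b v) (hu : u ∈ U) (k : Fin n) :
    partialDeriv a k u = partialDeriv b k u := by
  rw [partialDeriv, Filter.EventuallyEq.fderiv_eq ((hU.eventually_mem hu).mono hab), partialDeriv]

theorem partialDeriv_comm (hU : IsOpen U) (ha : ContDiffOn ℝ ∞ a U) (hu : u ∈ U) (k m : Fin n) :
    partialDeriv (partialDeriv a k) m u = partialDeriv (partialDeriv a m) k u :=
  fderiv_fderiv_apply_comm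
    ((ha.contDiffAt (hU.mem_nhds hu)).of_le (WithTop.coe_le_coe.2 le_top)) _ _

theorem differentiableAt_of_contDiffOn (hU : IsOpen U) (ha : ContDiffOn ℝ ∞ a U) (hu : u ∈ U) :
    DifferentiableAt ℝ a u :=
  (ha.contDiffAt (hU.mem_nhds hu)).differentiableAt (by simp)

end PartialDerivatives

section LieSymbol

variable {n : ℕ} {U : Set (Fin n → ℝ)} {g : (Fin n → ℝ) → Matrix (Fin n) (Fin n) ℝ}
  {Γ : (Fin n → ℝ) → Fin n → Fin n → Fin n → ℝ} {f : (Fin n → ℝ) → Fin n → ℝ}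
  {u : Fin n → ℝ}

namespace SmoothCoefficients

theorem differentiableAt_metric (hc : SmoothCoefficients U g Γ f) (hu : u ∈ U) (i j : Fin n) :
    DifferentiableAt ℝ (fun v => g v i j) u :=
  differentiableAt_of_contDiffOn hc.isOpen (hc.metric i j) hu

theorem differentiableAt_symbol (hc : SmoothCoefficients U g Γ f) (hu : u ∈ U) (i j k : Fin n) :
    DifferentiableAt ℝ (fun v => Γ v i j k) u :=
  differentiableAt_of_contDiffOn hc.isOpen (hc.symbol i j k) hu

theorem partialDeriv_lieMetric (hc : SmoothCoefficients U g Γ f) (hs : SkewRelations U g Γ)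
    (hu : u ∈ U) (i j k : Fin n) : partialDeriv (fun v => lieMetric g f v i j) k u =
      lieSymbol g Γ f u i j k + lieSymbol g Γ f u j i k := by
  have hf : ∀ m, DifferentiableAt ℝ (fun v => f v m) u := fun m =>
    differentiableAt_of_contDiffOn hc.isOpen (hc.vector m) hu
  have hdf : ∀ i m, DifferentiableAt ℝ (partialDeriv (fun v => f v i) m) u := fun i m =>
    differentiableAt_of_contDiffOn hc.isOpen (contDiffOn_partialDeriv hc.isOpen (hc.vector i) m) hu
  have hdg : ∀ m, DifferentiableAt ℝ (partialDeriv (fun v => g v i j) m) u := fun m =>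
    differentiableAt_of_contDiffOn hc.isOpen
      (contDiffOn_partialDeriv hc.isOpen (hc.metric i j) m) hu
  have hddg : ∀ m, partialDeriv (partialDeriv (fun v => g v i j) m) k u =
      partialDeriv (fun v => Γ v i j k) m u + partialDeriv (fun v => Γ v j i k) m u := fun m => by
    rw [partialDeriv_comm hc.isOpen (hc.metric i j) hu,
      partialDeriv_congr hc.isOpen (fun v hv => hs.compat v hv i j k) hu,
      partialDeriv_add (hc.differentiableAt_symbol hu i j k) (hc.differentiableAt_symbol hu j i k)]
  have hg := fun i m => hc.differentiableAt_metric hu i m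
  simp only [lieMetric, lieSymbol, ← Finset.sum_add_distrib]
  rw [partialDeriv_sum fun m _ => (((hf m).fun_mul (hdg m)).fun_sub
    ((hg m j).fun_mul (hdf i m))).fun_sub ((hg i m).fun_mul (hdf j m))]
  refine Finset.sum_congr rfl fun m _ => ?_
  rw [partialDeriv_sub (((hf m).fun_mul (hdg m)).fun_sub ((hg m j).fun_mul (hdf i m)))
      ((hg i m).fun_mul (hdf j m)),
    partialDeriv_sub ((hf m).fun_mul (hdg m)) ((hg m j).fun_mul (hdf i m)),
    partialDeriv_mul (hf m) (hdg m), partialDeriv_mul (hg m j) (hdf i m),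
    partialDeriv_mul (hg i m) (hdf j m), hddg, hs.symm u hu m j]
  simp only [hs.compat u hu]
  ring

theorem sum_partialDeriv_raisedSymbol (hc : SmoothCoefficients U g Γ f) (hu : u ∈ U)
    (hlie : lieMetric g f u = 0) (j i l : Fin n) :
    ∑ m, f u m * partialDeriv (fun v => raisedSymbol g Γ v j i l) m u =
      (∑ k, ∑ m, (f u m * partialDeriv (fun v => Γ v j i k) m u +
        Γ u j i m * partialDeriv (fun v => f v m) k u) * g u k l) +
      ∑ m, raisedSymbol g Γ u j i m * partialDeriv (fun v => f v l) m u := by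
  have hflow : ∀ k, ∑ m, f u m * partialDeriv (fun v => g v k l) m u =
      (∑ m, g u m l * partialDeriv (fun v => f v k) m u) +
        ∑ m, g u k m * partialDeriv (fun v => f v l) m u := fun k => by
    have := congrFun₂ hlie k l
    simp only [lieMetric, Finset.sum_sub_distrib, Matrix.zero_apply] at this
    linear_combination this
  have hproduct : ∀ m, partialDeriv (fun v => raisedSymbol g Γ v j i l) m u =
      ∑ k, (partialDeriv (fun v => Γ v j i k) m u * g u k l +
        Γ u j i k * partialDeriv (fun v => g v k l) m u) := fun m => by
    simp only [raisedSymbol]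
    rw [partialDeriv_sum fun k _ => (hc.differentiableAt_symbol hu j i k).fun_mul
      (hc.differentiableAt_metric hu k l)]
    exact Finset.sum_congr rfl fun k _ => partialDeriv_mul
      (hc.differentiableAt_symbol hu j i k) (hc.differentiableAt_metric hu k l) m
  calc _ = (∑ k, ∑ m, f u m * partialDeriv (fun v => Γ v j i k) m u * g u k l) +
        ∑ k, Γ u j i k * ∑ m, f u m * partialDeriv (fun v => g v k l) m u := by
        simp only [hproduct, Finset.mul_sum]
        rw [Finset.sum_comm, ← Finset.sum_add_distrib]
        simp only [← Finset.sum_add_distrib]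
        exact Finset.sum_congr rfl fun k _ => Finset.sum_congr rfl fun m _ => by ring
    _ = _ := by
        simp only [hflow, raisedSymbol, mul_add, add_mul, Finset.sum_add_distrib, Finset.mul_sum,
          Finset.sum_mul]
        rw [Finset.sum_comm (f := fun m k => Γ u j i k * g u k m * _),
          Finset.sum_comm (f := fun k m => Γ u j i m * _ * g u k l)]
        simp only [mul_assoc, mul_comm (partialDeriv _ _ _) (g u _ _), add_assoc]

/-- The expansion exhibits the left-hand side as the Lie derivative of `raisedSymbol` up to a term
in the second derivatives of `f`; it is thus symmetric in `j` and `l` when `raisedSymbol` is. -/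
theorem sum_lieSymbol_mul_metric (hc : SmoothCoefficients U g Γ f) (hu : u ∈ U)
    (hlie : lieMetric g f u = 0) (j i l : Fin n) :
    ∑ k, lieSymbol g Γ f u j i k * g u k l =
      (∑ m, f u m * partialDeriv (fun v => raisedSymbol g Γ v j i l) m u) -
      (∑ m, raisedSymbol g Γ u j i m * partialDeriv (fun v => f v l) m u) -
      (∑ m, raisedSymbol g Γ u m i l * partialDeriv (fun v => f v j) m u) -
      (∑ m, raisedSymbol g Γ u j m l * partialDeriv (fun v => f v i) m u) -
      ∑ k, ∑ m, g u j m * partialDeriv (partialDeriv (fun v => f v i) m) k u * g u k l := by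
  rw [hc.sum_partialDeriv_raisedSymbol hu hlie]
  simp only [lieSymbol, raisedSymbol, Finset.sum_mul, sub_mul, add_mul, Finset.sum_sub_distrib,
    Finset.sum_add_distrib]
  rw [Finset.sum_comm (f := fun m k => Γ u m i k * g u k l * _),
    Finset.sum_comm (f := fun m k => Γ u j m k * g u k l * _)]
  simp only [mul_assoc, mul_comm (partialDeriv _ _ _)]
  ring

theorem sum_lieSymbol_mul_metric_comm (hc : SmoothCoefficients U g Γ f)
    (hs : SkewRelations U g Γ) (ht : IsTorsionFree U g Γ) (hu : u ∈ U)
    (hlie : lieMetric g f u = 0) (j i l : Fin n) :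
    ∑ k, lieSymbol g Γ f u j i k * g u k l = ∑ k, lieSymbol g Γ f u l i k * g u k j := by
  have hsecond : ∑ k, ∑ m, g u j m * partialDeriv (partialDeriv (fun v => f v i) m) k u * g u k l =
      ∑ k, ∑ m, g u l m * partialDeriv (partialDeriv (fun v => f v i) m) k u * g u k j := by
    rw [Finset.sum_comm]
    refine Finset.sum_congr rfl fun m _ => Finset.sum_congr rfl fun k _ => ?_
    rw [partialDeriv_comm hc.isOpen (hc.vector i) hu m k, hs.symm u hu j m, hs.symm u hu k l]
    ring
  rw [hc.sum_lieSymbol_mul_metric hu hlie, hc.sum_lieSymbol_mul_metric hu hlie, hsecond]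
  simp only [partialDeriv_congr hc.isOpen (fun v hv => ht v hv j i l) hu, ht u hu j _ _,
    ht u hu _ i l]
  ring

/-- The difference tensor of two torsion-free connections compatible with one metric is symmetric
in one pair of indices and skew in another, as in the uniqueness of the Levi-Civita connection. -/
theorem lieSymbol_eq_zero (hc : SmoothCoefficients U g Γ f) (hs : SkewRelations U g Γ)
    (ht : IsTorsionFree U g Γ) (hf : IsInfinitesimalIsometry U g f) (hu : u ∈ U)
    (hdet : (g u).det ≠ 0) : lieSymbol g Γ f u = 0 := by
  have hlie : ∀ v ∈ U, lieMetric g f v = 0 := isInfinitesimalIsometry_iff_lieMetric_eq_zero.1 hf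
  have hskew : ∀ i j k, lieSymbol g Γ f u i j k = -lieSymbol g Γ f u j i k := fun i j k => by
    rw [eq_neg_iff_add_eq_zero, ← hc.partialDeriv_lieMetric hs hu,
      partialDeriv_congr hc.isOpen (b := fun _ => 0) (fun v hv => congrFun₂ (hlie v hv) i j) hu]
    simp [partialDeriv]
  set W : Fin n → Fin n → Fin n → ℝ := fun j i l => ∑ k, lieSymbol g Γ f u j i k * g u k l
  have hW_symm : ∀ j i l, W j i l = W l i j :=
    hc.sum_lieSymbol_mul_metric_comm hs ht hu (hlie u hu)
  have hW_skew : ∀ j i l, W j i l = -W i j l := fun j i l => by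
    simp only [W, ← Finset.sum_neg_distrib, ← neg_mul, ← hskew]
  have hW : ∀ j i l, W j i l = 0 := fun j i l => by
    linarith [hW_symm j i l, hW_skew l i j, hW_symm i l j, hW_skew j l i, hW_symm l j i,
      hW_skew i j l]
  funext j i
  exact Matrix.eq_zero_of_vecMul_eq_zero hdet (funext fun l => hW j i l)

end SmoothCoefficients

end LieSymbol

section Pencil

variable {n : ℕ} {U : Set (Fin n → ℝ)} {g h : (Fin n → ℝ) → Matrix (Fin n) (Fin n) ℝ}
  {Γ Δ : (Fin n → ℝ) → Fin n → Fin n → Fin n → ℝ} {f : (Fin n → ℝ) → Fin n → ℝ} {u : Fin n → ℝ}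

theorem weaklyNonlocal_zero (g : (Fin n → ℝ) → Matrix (Fin n) (Fin n) ℝ)
    (Γ : (Fin n → ℝ) → Fin n → Fin n → Fin n → ℝ) (f : (Fin n → ℝ) → Fin n → ℝ) :
    weaklyNonlocal g Γ f 0 = hydroOperator g Γ := by
  rw [weaklyNonlocal, zero_smul, add_zero]

theorem weaklyNonlocal_one (g : (Fin n → ℝ) → Matrix (Fin n) (Fin n) ℝ)
    (Γ : (Fin n → ℝ) → Fin n → Fin n → Fin n → ℝ) (f : (Fin n → ℝ) → Fin n → ℝ) :
    weaklyNonlocal g Γ f 1 = hydroOperator g Γ + tailOperator f := by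
  rw [weaklyNonlocal, one_smul]

theorem hydroOperator_add_smul (c : ℝ) :
    hydroOperator (g + c • h) (Γ + c • Δ) = hydroOperator g Γ + c • hydroOperator h Δ := by
  funext u ψ x i
  simp only [hydroOperator, Pi.add_apply, Pi.smul_apply, Matrix.add_apply, Matrix.smul_apply,
    smul_eq_mul, Finset.mul_sum, ← Finset.sum_add_distrib]
  refine Finset.sum_congr rfl fun j _ => ?_
  simp only [add_mul, mul_add, Finset.sum_add_distrib, Finset.mul_sum, mul_assoc]
  ring

theorem hydroOperator_add_smul_weaklyNonlocal (c ε : ℝ) :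
    hydroOperator h Δ + c • weaklyNonlocal g Γ f ε =
      weaklyNonlocal (h + c • g) (Δ + c • Γ) f (c * ε) := by
  rw [weaklyNonlocal, weaklyNonlocal, hydroOperator_add_smul, smul_add, smul_smul, add_assoc]

namespace SmoothCoefficients

theorem add_smul (hg : SmoothCoefficients U g Γ f) (hh : SmoothCoefficients U h Δ f) (c : ℝ) :
    SmoothCoefficients U (g + c • h) (Γ + c • Δ) f where
  isOpen := hg.isOpen
  metric i j := (hg.metric i j).add (contDiffOn_const.mul (hh.metric i j))
  symbol i j k := (hg.symbol i j k).add (contDiffOn_const.mul (hh.symbol i j k))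
  vector := hg.vector

theorem lieMetric_add_smul (hg : SmoothCoefficients U g Γ f) (hh : SmoothCoefficients U h Δ f)
    (hu : u ∈ U) (c : ℝ) :
    lieMetric (g + c • h) f u = lieMetric g f u + c • lieMetric h f u := by
  ext i j
  simp only [lieMetric, Pi.add_apply, Pi.smul_apply, Matrix.add_apply, Matrix.smul_apply,
    smul_eq_mul, Finset.mul_sum, ← Finset.sum_add_distrib,
    partialDeriv_add_const_mul (hg.differentiableAt_metric hu i j)
      (hh.differentiableAt_metric hu i j)]
  exact Finset.sum_congr rfl fun k _ => by ring

theorem lieSymbol_add_smul (hg : SmoothCoefficients U g Γ f) (hh : SmoothCoefficients U h Δ f)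
    (hu : u ∈ U) (c : ℝ) :
    lieSymbol (g + c • h) (Γ + c • Δ) f u = lieSymbol g Γ f u + c • lieSymbol h Δ f u := by
  funext i j k
  simp only [lieSymbol, Pi.add_apply, Pi.smul_apply, Matrix.add_apply, Matrix.smul_apply,
    smul_eq_mul, Finset.mul_sum, ← Finset.sum_add_distrib,
    partialDeriv_add_const_mul (hg.differentiableAt_symbol hu i j k)
      (hh.differentiableAt_symbol hu i j k)]
  exact Finset.sum_congr rfl fun m _ => by ring

theorem isInfinitesimalIsometry_add_smul (hg : SmoothCoefficients U g Γ f)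
    (hh : SmoothCoefficients U h Δ f) (hfg : IsInfinitesimalIsometry U g f)
    (hfh : IsInfinitesimalIsometry U h f) (c : ℝ) : IsInfinitesimalIsometry U (g + c • h) f := by
  rw [isInfinitesimalIsometry_iff_lieMetric_eq_zero] at hfg hfh ⊢
  intro u hu
  rw [hg.lieMetric_add_smul hh hu, hfg u hu, hfh u hu, smul_zero, add_zero]

end SmoothCoefficients

end Pencil

section Plane

variable {U : Set (Fin 2 → ℝ)} {g h : (Fin 2 → ℝ) → Matrix (Fin 2) (Fin 2) ℝ}
  {Γ Δ : (Fin 2 → ℝ) → Fin 2 → Fin 2 → Fin 2 → ℝ} {f : (Fin 2 → ℝ) → Fin 2 → ℝ} {ε : ℝ}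

theorem SmoothCoefficients.cyclicSum_jacobiTerm_eq_integral_localTerm
    (hc : SmoothCoefficients U g Γ f) (hs : SkewRelations U g Γ)
    (hf : IsInfinitesimalIsometry U g f) (hlie : ∀ u ∈ U, lieSymbol g Γ f u = 0)
    {u φ ψ χ : ℝ → Fin 2 → ℝ} (hu : IsSmoothIn U u) (hφ : IsTest φ) (hψ : IsTest ψ)
    (hχ : IsTest χ) :
    cyclicSum (jacobiTerm g Γ f ε u) φ ψ χ = ∫ x, cyclicSum (localTerm g Γ u) φ ψ χ x := by
  have hzero : ∀ ψ, hydroOperator (lieMetric g f) (lieSymbol g Γ f) u ψ = 0 := fun ψ => by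
    funext x i
    simp [hydroOperator, hlie _ (hu.mem x),
      isInfinitesimalIsometry_iff_lieMetric_eq_zero.1 hf _ (hu.mem x)]
  rw [hc.cyclicSum_jacobiTerm_eq_integral_lieTerm hs hu hφ hψ hχ]
  simp only [cyclicSum_lieTerm_eq_zero hs hf hu.mem hzero, mul_zero, add_zero]

namespace IsHamiltonian

theorem skewRelations (hc : SmoothCoefficients U g Γ f)
    (hP : IsHamiltonian U (weaklyNonlocal g Γ f ε)) : SkewRelations U g Γ :=
  (isSkewOn_weaklyNonlocal_iff_skewRelations hc).1 (hc.isHamiltonian_weaklyNonlocal_iff.1 hP).1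

theorem jacobiAt_const (hc : SmoothCoefficients U g Γ f)
    (hP : IsHamiltonian U (weaklyNonlocal g Γ f ε)) {u₀ : Fin 2 → ℝ} (hu₀ : u₀ ∈ U) :
    JacobiAt g Γ f ε fun _ => u₀ :=
  (hc.isHamiltonian_weaklyNonlocal_iff.1 hP).2 _ (isFieldIn_const hu₀)

theorem isInfinitesimalIsometry (hc : SmoothCoefficients U g Γ f)
    (hP : IsHamiltonian U (weaklyNonlocal g Γ f ε)) (hε : ε ≠ 0) :
    IsInfinitesimalIsometry U g f :=
  hc.isInfinitesimalIsometry_of_ne_zero fun _ hu hf =>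
    hc.lieMetric_eq_zero_of_jacobiAt_const (hP.skewRelations hc) hε hu hf (hP.jacobiAt_const hc hu)

theorem isTorsionFree (hc : SmoothCoefficients U g Γ f)
    (hP : IsHamiltonian U (weaklyNonlocal g Γ f ε)) (hf : IsInfinitesimalIsometry U g f) :
    IsTorsionFree U g Γ := fun u hu => by
  have hs := hP.skewRelations hc
  have hlie : ∀ ψ, hydroOperator (lieMetric g f) (lieSymbol g Γ f) (fun _ => u) ψ = 0 := fun ψ => by
    funext x i
    simp [hydroOperator, isInfinitesimalIsometry_iff_lieMetric_eq_zero.1 hf u hu]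
  exact hc.raisedSymbol_comm_of_jacobiAt_const hs hu
    (cyclicSum_lieTerm_eq_zero hs hf (fun _ => hu) hlie) (hP.jacobiAt_const hc hu)

theorem lieSymbol_eq_zero (hc : SmoothCoefficients U g Γ f)
    (hP : IsHamiltonian U (weaklyNonlocal g Γ f ε)) (hf : IsInfinitesimalIsometry U g f)
    (hdet : ∀ u ∈ U, (g u).det ≠ 0) : ∀ u ∈ U, lieSymbol g Γ f u = 0 := fun u hu =>
  hc.lieSymbol_eq_zero (hP.skewRelations hc) (hP.isTorsionFree hc hf) hf hu (hdet u hu)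

theorem weaklyNonlocal_of_lieSymbol_eq_zero (hc : SmoothCoefficients U g Γ f)
    (hP : IsHamiltonian U (weaklyNonlocal g Γ f ε)) (hf : IsInfinitesimalIsometry U g f)
    (hlie : ∀ u ∈ U, lieSymbol g Γ f u = 0) (ε' : ℝ) :
    IsHamiltonian U (weaklyNonlocal g Γ f ε') := by
  have hs := hP.skewRelations hc
  refine hc.isHamiltonian_weaklyNonlocal_iff.2
    ⟨(isSkewOn_weaklyNonlocal_iff_skewRelations hc).2 hs, fun u hu φ ψ χ hφ hψ hχ => ?_⟩
  have hJ := (hc.isHamiltonian_weaklyNonlocal_iff.1 hP).2 u hu φ ψ χ hφ hψ hχ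
  rwa [hc.cyclicSum_jacobiTerm_eq_integral_localTerm hs hf hlie hu.isSmoothIn hφ hψ hχ] at hJ ⊢

end IsHamiltonian

theorem IsBiHamiltonianPair.weaklyNonlocal_of_isometry (hh : SmoothCoefficients U h Δ f)
    (hg : SmoothCoefficients U g Γ f)
    (hPQ : IsBiHamiltonianPair U (hydroOperator h Δ) (weaklyNonlocal g Γ f ε))
    (hfh : IsInfinitesimalIsometry U h f) (hfg : IsInfinitesimalIsometry U g f)
    (hdeth : ∀ u ∈ U, (h u).det ≠ 0) (hdetg : ∀ u ∈ U, (g u).det ≠ 0) (ε' : ℝ) :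
    IsBiHamiltonianPair U (hydroOperator h Δ) (weaklyNonlocal g Γ f ε') := by
  obtain ⟨hP, hQ, hpencil⟩ := hPQ
  have hlieh := IsHamiltonian.lieSymbol_eq_zero hh ((weaklyNonlocal_zero h Δ f).symm ▸ hP) hfh hdeth
  have hlieg := hQ.lieSymbol_eq_zero hg hfg hdetg
  refine ⟨hP, hQ.weaklyNonlocal_of_lieSymbol_eq_zero hg hfg hlieg ε', fun c => ?_⟩
  have hlie : ∀ u ∈ U, lieSymbol (h + c • g) (Δ + c • Γ) f u = 0 := fun u hu => by
    rw [hh.lieSymbol_add_smul hg hu, hlieh u hu, hlieg u hu, smul_zero, add_zero]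
  have hR := hpencil c
  rw [hydroOperator_add_smul_weaklyNonlocal] at hR ⊢
  exact hR.weaklyNonlocal_of_lieSymbol_eq_zero (hh.add_smul hg c)
    (hh.isInfinitesimalIsometry_add_smul hg hfh hfg c) hlie _

theorem IsBiHamiltonianPair.isInfinitesimalIsometry (hh : SmoothCoefficients U h Δ f)
    (hg : SmoothCoefficients U g Γ f)
    (hPQ : IsBiHamiltonianPair U (hydroOperator h Δ) (weaklyNonlocal g Γ f ε)) (hε : ε ≠ 0) :
    IsInfinitesimalIsometry U h f ∧ IsInfinitesimalIsometry U g f := by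
  have hfg := hPQ.2.1.isInfinitesimalIsometry hg hε
  have hsum := hPQ.2.2 1
  rw [hydroOperator_add_smul_weaklyNonlocal, one_mul] at hsum
  refine ⟨isInfinitesimalIsometry_iff_lieMetric_eq_zero.2 fun u hu => ?_, hfg⟩
  have hlie := isInfinitesimalIsometry_iff_lieMetric_eq_zero.1
    (hsum.isInfinitesimalIsometry (hh.add_smul hg 1) hε) u hu
  rwa [hh.lieMetric_add_smul hg hu, isInfinitesimalIsometry_iff_lieMetric_eq_zero.1 hfg u hu,
    smul_zero, add_zero] at hlie

end Plane

theorem theorem1_general (U : Set (Fin 2 → ℝ)) (hU : IsOpen U)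
    (h g : (Fin 2 → ℝ) → Matrix (Fin 2) (Fin 2) ℝ)
    (Δ Γ : (Fin 2 → ℝ) → Fin 2 → Fin 2 → Fin 2 → ℝ)
    (f : (Fin 2 → ℝ) → Fin 2 → ℝ)
    (hh_smooth : ∀ i j, ContDiffOn ℝ ∞ (fun u => h u i j) U)
    (hΔ_smooth : ∀ i j k, ContDiffOn ℝ ∞ (fun u => Δ u i j k) U)
    (hg_smooth : ∀ i j, ContDiffOn ℝ ∞ (fun u => g u i j) U)
    (hΓ_smooth : ∀ i j k, ContDiffOn ℝ ∞ (fun u => Γ u i j k) U)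
    (hf_smooth : ∀ i, ContDiffOn ℝ ∞ (fun u => f u i) U)
    (hh : ∀ u ∈ U, (h u).det ≠ 0) (hg : ∀ u ∈ U, (g u).det ≠ 0) :
    (IsBiHamiltonianPair U (hydroOperator h Δ) (hydroOperator g Γ + tailOperator f) ↔
      IsBiHamiltonianPair U (hydroOperator h Δ) (hydroOperator g Γ) ∧
        (IsInfinitesimalIsometry U h f ∧ IsInfinitesimalIsometry U g f)) ∧
    (IsInfinitesimalIsometry U h f → IsInfinitesimalIsometry U g f →
      ∀ c : ℝ, IsInfinitesimalIsometry U (g + c • h) f) := by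
  have hch : SmoothCoefficients U h Δ f := ⟨hU, hh_smooth, hΔ_smooth, hf_smooth⟩
  have hcg : SmoothCoefficients U g Γ f := ⟨hU, hg_smooth, hΓ_smooth, hf_smooth⟩
  rw [← weaklyNonlocal_one, ← weaklyNonlocal_zero g Γ f]
  refine ⟨⟨fun hpair => ?_, fun ⟨hpair, hfh, hfg⟩ => ?_⟩, fun hfh hfg c =>
    hcg.isInfinitesimalIsometry_add_smul hch hfg hfh c⟩
  · have hf := hpair.isInfinitesimalIsometry hch hcg one_ne_zero
    exact ⟨hpair.weaklyNonlocal_of_isometry hch hcg hf.1 hf.2 hh hg 0, hf⟩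
  · exact hpair.weaklyNonlocal_of_isometry hch hcg hfh hfg hh hg 1

theorem theorem1 (U : Set (Fin 2 → ℝ)) (hU : IsOpen U)
    (η : Matrix (Fin 2) (Fin 2) ℝ) (hη_symm : η.IsSymm) (hη : η.det ≠ 0)
    (g : (Fin 2 → ℝ) → Matrix (Fin 2) (Fin 2) ℝ)
    (Γ : (Fin 2 → ℝ) → Fin 2 → Fin 2 → Fin 2 → ℝ)
    (f : (Fin 2 → ℝ) → Fin 2 → ℝ)
    (hg_smooth : ∀ i j, ContDiffOn ℝ ∞ (fun u => g u i j) U)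
    (hΓ_smooth : ∀ i j k, ContDiffOn ℝ ∞ (fun u => Γ u i j k) U)
    (hf_smooth : ∀ i, ContDiffOn ℝ ∞ (fun u => f u i) U)
    (hg : ∀ u ∈ U, (g u).det ≠ 0) :
    (IsBiHamiltonianPair U (hydroOperator (fun _ => η) 0) (hydroOperator g Γ + tailOperator f) ↔
      IsBiHamiltonianPair U (hydroOperator (fun _ => η) 0) (hydroOperator g Γ) ∧
        (IsInfinitesimalIsometry U (fun _ => η) f ∧ IsInfinitesimalIsometry U g f)) ∧
    (IsInfinitesimalIsometry U (fun _ => η) f → IsInfinitesimalIsometry U g f →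
      ∀ c : ℝ, IsInfinitesimalIsometry U (fun u => g u + c • η) f) :=
  theorem1_general U hU (fun _ => η) g 0 Γ f (fun _ _ => contDiffOn_const)
    (fun _ _ _ => contDiffOn_const) hg_smooth hΓ_smooth hf_smooth (fun _ _ => hη) hg
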